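/- **Setting.** Let $E$ be a set and $X=\{X(t):t\in E\}$ a real-valued stochastic process, $F(t,x)=\Pr(X(t)\le x)$. Let $(\Omega,\mathcal A,Q)$ be a probability space carrying independent copies $X_1,X_2,\dots$ of $X$ and a process $G=\{G(t,x):(t,x)\in E\times\mathbb R\}$. Put $$F_n(t,x)=\frac1n\sum_{i=1}^n \mathbf 1\{X_i(t)\le x\},\qquad \nu_n(t,x)=\sqrt n\,(F_n(t,x)-F(t,x)),\qquad \tau_\alpha(t)=\inf\{x:F(t,x)\ge\alpha\}.$$ For a set $S$, let $\ell_\infty(S)$ be the Banach space of bounded real functions on $S$ with the supremum norm. Processes $Y_n=\{Y_n(s):s\in S\}$ *satisfy the CLT in $\ell_\infty(S)$ with Gaussian limit process $Z$* if $Z$ is a centered Gaussian process with paths in $\ell_\infty(S)$, Borel measurable with separable range there, and $\mathbb E^*H(Y_n)\to\mathbb E H(Z)$ for every bounded continuous $H:\ell_\infty(S)\to\mathbb R$, where $\mathbb E^*$ is the upper expectation. (If $Y_n$ may have unbounded paths, this is required for every bounded extension of $H$ to all real functions on $S$, which includes that the outer probability of $Y_n\notin\ell_\infty(S)$ tends to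 $0$.) For a nonnegative function $h$ on a probability space, $h^*$ denotes its measurable cover, i.e. its a.s. smallest measurable majorant with values in $[0,\infty]$. **Assumptions.** 1. For every $t\in E$, $F(t,\cdot)$ is strictly increasing and has a density $f(t,\cdot)$. 2. $\displaystyle\lim_{\delta\to0}\ \sup_{t\in E}\ \sup_{|u-v|\le\delta}|f(t,u)-f(t,v)|=0$. 3. For every closed interval $I=[a,b]\subset(0,1)$ there is $\theta(I)>0$ such that $\inf\{f(t,x):t\in E,\ \alpha\in I,\ |x-\tau_\alpha(t)|\le\theta(I)\}>0$. 4. The empirical CLT over $\mathcal C=\{\{z:z(t)\le x\}:t\in E,\,x\in\mathbb R\}$ holds: the processes $\nu_n$ satisfy the CLT in $\ell_\infty(E\times\mathbb R)$ with Gaussian limit process $G$, where $G$ has covariance $\mathbb E\,G(s,x)G(t,y)=\mathbb E\big[(\mathbf 1\{X(s)\le x\}-F(s,x))(\mathbf 1\{X(t)\le y\}-F(t,y))\big]$. **Conclusion.** There is a Skorokhod–Dudley representation, i.e. a probability space $(\widehat\Omega,\widehat{\mathcal F},\widehat P)$ and measurable maps $g_n:\widehat\Omega\to\Omega$, $n\ge0$,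 with $\widehat P\circ g_n^{-1}=Q$, which are perfect (that is, $(h\circ g_n)^*=h^*\circ g_n$ $\widehat P$-a.s. for every $h:\Omega\to[0,\infty]$, with $h^*$ formed under $Q$) and satisfy $$\Big(\sup_{t\in E,\,x\in\mathbb R}|\nu_n(t,x)\circ g_n-G(t,x)\circ g_0|\Big)^*\to0\quad \widehat P\text{-a.s.}$$ Moreover, for every such representation, with $\widehat F_n(t,x)=F_n(t,x)\circ g_n$, $\widehat G=G\circ g_0$ and $\widehat\tau^n_\alpha(t)=\inf\{x:\widehat F_n(t,x)\ge\alpha\}$, and for every closed interval $I=[a,b]\subset(0,1)$: (i) $\displaystyle\Big(\sup_{t\in E,\,\alpha\in I}\big|\sqrt n\,(\widehat\tau^n_\alpha(t)-\tau_\alpha(t))\,f(t,\tau_\alpha(t))+\widehat G(t,\tau_\alpha(t))\big|\Big)^*\to0$ in $\widehat P$-probability; (ii) the processes $\sqrt n\,(\widehat\tau^n_\alpha(t)-\tau_\alpha(t))f(t,\tau_\alpha(t))$, $(t,\alpha)\in E\times I$, satisfy the CLT in $\ell_\infty(E\times I)$ with Gaussian limit process $\widehat G(t,\tau_\alpha(t))$;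 (iii) the processes $\sqrt n\,(\widehat\tau^n_\alpha(t)-\tau_\alpha(t))$, $(t,\alpha)\in E\times I$, satisfy the CLT in $\ell_\infty(E\times I)$ with Gaussian limit process $\widehat G(t,\tau_\alpha(t))/f(t,\tau_\alpha(t))$. -/

import Mathlib

open MeasureTheory ProbabilityTheory Filter Topology
open scoped ENNReal

universe u v

namespace QuantileCLT

noncomputable section

/-! ### Outer expectations, measurable covers, perfect maps -/

/-- The upper expectation `E^* h` of a bounded, possibly non-measurable, function `h`: the infimum
of the expectations of the integrable functions that dominate `h`. -/
def upperExp {Ω : Type*} [MeasurableSpace Ω] (μ : Measure Ω) (h : Ω → ℝ) : ℝ :=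
  sInf {r | ∃ U : Ω → ℝ, Integrable U μ ∧ (∀ ω, h ω ≤ U ω) ∧ r = ∫ ω, U ω ∂μ}

/-- The measurable cover `f^*` of `f : Ω → [0, ∞]`, built from the measurable hulls of the
superlevel sets of `f`; see `measurable_cover`, `le_cover` and `cover_le_ae`. -/
def cover {Ω : Type*} [MeasurableSpace Ω] (μ : Measure Ω) (f : Ω → ℝ≥0∞) : Ω → ℝ≥0∞ :=
  fun ω => ⨆ q : ℚ, (toMeasurable μ {ω' | ENNReal.ofReal (q : ℝ) < f ω'}).indicator
    (fun _ => ENNReal.ofReal (q : ℝ)) ω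

theorem measurable_cover {Ω : Type*} [MeasurableSpace Ω] (μ : Measure Ω) (f : Ω → ℝ≥0∞) :
    Measurable (cover μ f) :=
  Measurable.iSup fun _ => measurable_const.indicator (measurableSet_toMeasurable _ _)

theorem le_cover {Ω : Type*} [MeasurableSpace Ω] (μ : Measure Ω) (f : Ω → ℝ≥0∞) (ω : Ω) :
    f ω ≤ cover μ f ω := by
  refine le_of_forall_lt fun c hc => ?_
  obtain ⟨q, -, hcq, hqf⟩ := ENNReal.lt_iff_exists_rat_btwn.1 hc
  refine hcq.trans_le ?_
  have hmem : ω ∈ toMeasurable μ {ω' | ENNReal.ofReal (q : ℝ) < f ω'} :=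
    subset_toMeasurable _ _ hqf
  refine le_trans ?_ (le_iSup (fun q : ℚ => (toMeasurable μ
    {ω' | ENNReal.ofReal (q : ℝ) < f ω'}).indicator (fun _ => ENNReal.ofReal (q : ℝ)) ω) q)
  simp only [Set.indicator_of_mem hmem]
  exact le_rfl

/-- The cover is the smallest measurable majorant up to null sets. -/
theorem cover_le_ae {Ω : Type*} [MeasurableSpace Ω] (μ : Measure Ω) [IsFiniteMeasure μ]
    (f h : Ω → ℝ≥0∞) (hh : Measurable h) (hfh : f ≤ᵐ[μ] h) : cover μ f ≤ᵐ[μ] h := by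
  have key : ∀ q : ℚ, ∀ᵐ ω ∂μ, (toMeasurable μ {ω' | ENNReal.ofReal (q : ℝ) < f ω'}).indicator
      (fun _ => ENNReal.ofReal (q : ℝ)) ω ≤ h ω := by
    intro q
    set s := {ω' | ENNReal.ofReal (q : ℝ) < f ω'} with hs
    have hm : MeasurableSet {ω | h ω ≤ ENNReal.ofReal (q : ℝ)} :=
      measurableSet_le hh measurable_const
    have h0 : μ (toMeasurable μ s ∩ {ω | h ω ≤ ENNReal.ofReal (q : ℝ)}) = 0 := by
      rw [Measure.measure_toMeasurable_inter_of_sFinite hm]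
      refine measure_mono_null ?_ hfh
      rintro ω ⟨h1, h2⟩ h3
      have h2' : h ω ≤ ENNReal.ofReal (q : ℝ) := h2
      have h1' : ENNReal.ofReal (q : ℝ) < f ω := h1
      have h3' : f ω ≤ h ω := h3
      exact absurd (h1'.trans_le (h3'.trans h2')) (lt_irrefl _)
    filter_upwards [measure_eq_zero_iff_ae_notMem.1 h0] with ω hω
    by_cases hT : ω ∈ toMeasurable μ s
    · rw [Set.indicator_of_mem hT]
      by_contra hlt
      exact hω ⟨hT, (not_le.1 hlt).le⟩
    · rw [Set.indicator_of_notMem hT]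
      exact zero_le
  filter_upwards [ae_all_iff.2 key] with ω hω
  exact iSup_le hω

/-- A perfect map `g : (Ω', P) → (Ω, Q)`: measurable covers commute with composition with `g`. -/
def IsPerfectMap {Ω' Ω : Type*} [MeasurableSpace Ω'] [MeasurableSpace Ω]
    (P : Measure Ω') (Q : Measure Ω) (g : Ω' → Ω) : Prop :=
  ∀ T : Ω → ℝ≥0∞, cover P (T ∘ g) =ᵐ[P] cover Q T ∘ g

/-! ### Convergence in law in `ℓ_∞(S)` -/

/-- The Banach space `ℓ_∞(S)` of bounded real functions on `S`, with the supremum norm. -/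
abbrev LInf (S : Type*) : Type _ := lp (fun _ : S => ℝ) ∞

/-- `sup_{s ∈ S} |z s|`, as an element of `[0, ∞]`. -/
def supNorm {S : Type*} (z : S → ℝ) : ℝ≥0∞ := ⨆ s, ‖z s‖ₑ

/-- Convergence in law in `ℓ_∞(S)` of the processes `Y n` to `Z`: `E^* H(Y n) → E H(Z)` for each
bounded continuous `H` on `ℓ_∞(S)`. A path of `Y n` may be unbounded; the test functions `H` are
therefore given on all real functions on `S`, with continuity required on `ℓ_∞(S)` only. When all
paths are bounded this is the usual notion; in general it contains the assertion that the outer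
probability of `Y n ∉ ℓ_∞(S)` tends to zero, and otherwise ignores the values of `H` outside
`ℓ_∞(S)`. -/
def ConvergesInLaw {S Ω Ω' : Type*} [MeasurableSpace Ω] [MeasurableSpace Ω']
    (μ : Measure Ω) (Y : ℕ → Ω → S → ℝ) (ρ : Measure Ω') (Z : Ω' → S → ℝ) : Prop :=
  ∀ H : (S → ℝ) → ℝ, (∃ C : ℝ, ∀ z, |H z| ≤ C) →
    Continuous (fun z : LInf S => H (fun s => z s)) →
      Tendsto (fun n => upperExp μ (fun ω => H (Y n ω))) atTop (𝓝 (∫ ω, H (Z ω) ∂ρ))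

/-- The processes `Y n` satisfy the central limit theorem in `ℓ_∞(S)` with the centered Gaussian
limit process `Z`. The paths of `Z` lie in `ℓ_∞(S)`, and `Z` is Borel measurable with separable
range there (this is strong measurability), so that its law on `ℓ_∞(S)` is Radon. -/
structure SatisfiesCLT {S Ω Ω' : Type*} [MeasurableSpace Ω] [MeasurableSpace Ω']
    (μ : Measure Ω) (Y : ℕ → Ω → S → ℝ) (ρ : Measure Ω') (Z : Ω' → S → ℝ) : Prop where
  radon : ∃ Z' : Ω' → LInf S, StronglyMeasurable Z' ∧ ∀ ω s, Z' ω s = Z ω s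
  gaussian : IsGaussianProcess (fun s ω => Z ω s) ρ
  centered : ∀ s, ∫ ω, Z ω s ∂ρ = 0
  law : ConvergesInLaw μ Y ρ Z

/-- A Skorokhod-Dudley representation of `Y n → Z`: perfect measure preserving maps `g n` from
`(Ω', P)` to `(Ω, Q)` such that the cover of the distance of `Y n ∘ g n` and `Z ∘ g 0` tends to
zero almost surely. -/
structure IsRepresentation {S Ω Ω' : Type*} [MeasurableSpace Ω] [MeasurableSpace Ω']
    (Q : Measure Ω) (Y : ℕ → Ω → S → ℝ) (Z : Ω → S → ℝ)
    (P : Measure Ω') (g : ℕ → Ω' → Ω) : Prop where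
  prob : IsProbabilityMeasure P
  preserving : ∀ n, MeasurePreserving (g n) P Q
  perfect : ∀ n, IsPerfectMap P Q (g n)
  conv : ∀ᵐ ω ∂P, Tendsto
    (fun n => cover P (fun ω' => supNorm (fun s => Y n (g n ω') s - Z (g 0 ω') s)) ω)
    atTop (𝓝 0)

/-! ### Distribution functions, quantiles, the empirical CLT -/

/-- `F(t, x) = P(X(t) ≤ x)`. -/
def distF {E Ω₀ : Type*} [MeasurableSpace Ω₀] (P : Measure Ω₀) (X : Ω₀ → E → ℝ)
    (t : E) (x : ℝ) : ℝ :=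
  P.real {ω | X ω t ≤ x}

/-- `F_n(t, x)`, the empirical distribution function of the first `n` copies. -/
def empF {E Ω : Type*} (X : ℕ → Ω → E → ℝ) (n : ℕ) (ω : Ω) (t : E) (x : ℝ) : ℝ :=
  (1 / (n : ℝ)) * ∑ i ∈ Finset.range n, (Set.Iic x).indicator (fun _ => (1 : ℝ)) (X i ω t)

/-- The left-continuous inverse `inf {x | F x ≥ α}`. -/
def leftInv (F : ℝ → ℝ) (α : ℝ) : ℝ := sInf {x | α ≤ F x}

/-- The empirical process `ν_n(t, x) = √n (F_n(t, x) - F(t, x))`, indexed by `E × ℝ`. -/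
def empProcess {E Ω₀ Ω : Type*} [MeasurableSpace Ω₀] (P : Measure Ω₀) (X : Ω₀ → E → ℝ)
    (Xs : ℕ → Ω → E → ℝ) (n : ℕ) (ω : Ω) (p : E × ℝ) : ℝ :=
  √(n : ℝ) * (empF Xs n ω p.1 p.2 - distF P X p.1 p.2)

/-- The `Xs j` are independent copies of the process `X`. -/
structure IsIIDCopies {E Ω₀ Ω : Type*} [MeasurableSpace Ω₀] [MeasurableSpace Ω]
    (P : Measure Ω₀) (X : Ω₀ → E → ℝ) (Q : Measure Ω) (Xs : ℕ → Ω → E → ℝ) : Prop where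
  copy : ∀ j, IdentDistrib (Xs j) X Q P
  indep : iIndepFun Xs Q

/-- The empirical CLT over the sets `{z | z t ≤ x}`, `(t, x) ∈ E × ℝ`, with limit `G`. -/
structure EmpiricalCLT {E Ω₀ Ω : Type*} [MeasurableSpace Ω₀] [MeasurableSpace Ω]
    (P : Measure Ω₀) (X : Ω₀ → E → ℝ) (Q : Measure Ω) (Xs : ℕ → Ω → E → ℝ)
    (G : Ω → E × ℝ → ℝ) : Prop where
  clt : SatisfiesCLT Q (empProcess P X Xs) Q G
  covariance : ∀ (s t : E) (x y : ℝ), ∫ ω, G ω (s, x) * G ω (t, y) ∂Q =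
    ∫ ω, ((Set.Iic x).indicator (fun _ => (1 : ℝ)) (X ω s) - distF P X s x) *
      ((Set.Iic y).indicator (fun _ => (1 : ℝ)) (X ω t) - distF P X t y) ∂P

/-- `f(t, ·)` is a density of `X(t)` for each `t`. -/
structure HasDensities {E Ω₀ : Type*} [MeasurableSpace Ω₀] (P : Measure Ω₀) (X : Ω₀ → E → ℝ)
    (f : E → ℝ → ℝ) : Prop where
  nonneg : ∀ t x, 0 ≤ f t x
  density : ∀ t, P.map (fun ω => X ω t) = volume.withDensity (fun x => ENNReal.ofReal (f t x))

/-- For each closed interval `I = [a, b]` in `(0, 1)` there is `θ > 0` such that the infimum of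
`f(t, x)` over `t ∈ E`, `α ∈ I` and `|x - τ_α(t)| ≤ θ` is positive. -/
def BoundedBelowNearQuantiles {E Ω₀ : Type*} [MeasurableSpace Ω₀] (P : Measure Ω₀)
    (X : Ω₀ → E → ℝ) (f : E → ℝ → ℝ) : Prop :=
  ∀ a b : ℝ, 0 < a → a ≤ b → b < 1 → ∃ θ > 0, ∃ c > 0, ∀ t : E, ∀ α ∈ Set.Icc a b, ∀ x : ℝ,
    |x - leftInv (distF P X t) α| ≤ θ → c ≤ f t x

end

end QuantileCLT

/-!
The representation is Dudley's form of the Skorokhod theorem. The limit `Z` has separable range, so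
for each level `m` finitely many balls of radius `ε m = 2⁻ᵐ` around points `x i` carry it up to
probability `ε m`. Bumps around the `x i` and one auxiliary uniform variable label the points of
`Ω × [0, 1]`: the label `i` is given only near `x i`, with a probability just below the mean of the
`i`-th bump at `Z`, and a last label is left for an event of probability at most `2 ε m`. By
convergence in law the means of the bumps at `Y n` have lower expectations that eventually exceed
these probabilities, so that `Q` splits into a mixture whose `i`-th component lives where `Y n` is
near `x i` (`ConvergesInLaw.eventually_isMixture`). On the product of `Ω × [0, 1]` with one
independent factor `Ω` for each pair `(n, i)`, carrying the `i`-th component for `Y n`, the map `g n`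
picks the coordinate `(n, i)`, where `i` is the label at a level `m n` that tends slowly to infinity.
Then `g n` has law `Q`, and the Borel-Cantelli lemma shows that `Y n ∘ g n` is almost surely near
`Z ∘ g 0`. Perfectness is Fubini's theorem: given all other coordinates, the selected one has a law
absolutely continuous with respect to `Q` (`isPerfectMap_select`).

For the quantiles, almost all paths of `G` are uniformly continuous on the scale of `F`
(`EmpiricalCLT.ae_uniformlyContinuous`): the mean of `G` over an event is such a function, by the
Cauchy-Schwarz inequality and `E (G(t,x) - G(t,y))² ≤ |F(t,x) - F(t,y)|`, these functions form a
closed subset of `ℓ_∞`, and a strongly measurable function whose averages lie in a closed set has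
almost all its values there. Given such a path, bounded and close to `ν_n`, inverting `F_n` gives
`√n (F(τ̂) - F(τ)) ≈ -G(τ̂) ≈ -G(τ)`, and the mean value theorem with the lower bound and the
equicontinuity of the densities turns the left side into `√n (τ̂ - τ) f(τ)`
(`abs_quantile_add_le`). Boundedness, modulus of continuity and closeness to `ν_n` hold
simultaneously on measurable events of probability close to one, which bounds the measurable cover
and proves the first assertion.

The quantile processes thus approach `-G` and `-G / f`. That `G` and `G / f` are limits as well uses
the symmetry of the law of a centered Gaussian process with a Radon law in `ℓ_∞`
(`integral_comp_neg_eq`): on a separable closed subspace countably many coordinates form an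
injective continuous map into `ℕ → ℝ`, hence determine Borel measures.
-/

namespace QuantileCLT

/-! ### Perfect maps on product spaces -/

/-- Measurable covers only decrease when the measure is replaced by a dominating one: the cover
under `ν`, set to `∞` where the density of `ν` vanishes, is a majorant under `Q`. -/
theorem cover_le_ae_of_absolutelyContinuous {Ω : Type*} [MeasurableSpace Ω] {Q ν : Measure Ω}
    [IsFiniteMeasure Q] [IsFiniteMeasure ν] (hν : ν ≪ Q) (T : Ω → ℝ≥0∞) :
    cover Q T ≤ᵐ[ν] cover ν T := by
  classical
  set h : Ω → ℝ≥0∞ := fun ω => if ν.rnDeriv Q ω = 0 then ∞ else cover ν T ω with hh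
  have hm : Measurable h :=
    Measurable.ite (measurableSet_eq_fun (Measure.measurable_rnDeriv ν Q) measurable_const)
      measurable_const (measurable_cover ν T)
  have hle : cover Q T ≤ᵐ[Q] h := by
    refine cover_le_ae Q T h hm (Eventually.of_forall fun ω => ?_)
    by_cases h0 : ν.rnDeriv Q ω = 0
    · simp [hh, h0]
    · simpa [hh, h0] using le_cover ν T ω
  filter_upwards [hν.ae_le hle, Measure.rnDeriv_pos hν] with ω h1 h2
  simpa [hh, h2.ne'] using h1

/-- Resampling one coordinate of a product of probability measures does not change its law. -/
theorem measurePreserving_update {J Ω : Type*} [MeasurableSpace Ω] [DecidableEq J]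
    (ν : J → Measure Ω) [∀ j, IsProbabilityMeasure (ν j)] (j : J) :
    MeasurePreserving (fun p : (J → Ω) × Ω => Function.update p.1 j p.2)
      ((Measure.infinitePi ν).prod (ν j)) (Measure.infinitePi ν) := by
  have hm : Measurable (fun p : (J → Ω) × Ω => Function.update p.1 j p.2) := by
    refine measurable_pi_iff.2 fun i => ?_
    by_cases hi : i = j
    · subst hi; simpa using measurable_snd
    · simp only [Function.update_of_ne hi]
      exact (measurable_pi_apply i).comp measurable_fst
  refine ⟨hm, Measure.eq_infinitePi _ fun s t ht => ?_⟩
  rw [Measure.map_apply hm (MeasurableSet.pi s.countable_toSet fun i _ => ht i)]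
  by_cases hj : j ∈ s
  · have : (fun p : (J → Ω) × Ω => Function.update p.1 j p.2) ⁻¹' (Set.pi s t)
        = (Set.pi (s.erase j : Finset J) t) ×ˢ t j := by
      ext p
      simp only [Set.mem_preimage, Set.mem_pi, Set.mem_prod, Finset.coe_erase, Set.mem_sdiff,
        Set.mem_singleton_iff, Finset.mem_coe]
      constructor
      · intro h
        refine ⟨fun i hi => ?_, by simpa using h j hj⟩
        simpa [Function.update_of_ne hi.2] using h i hi.1
      · rintro ⟨h1, h2⟩ i hi
        by_cases hij : i = j
        · subst hij; simpa using h2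
        · simpa [Function.update_of_ne hij] using h1 i ⟨hi, hij⟩
    rw [this, Measure.prod_prod, Measure.infinitePi_pi _ (fun i _ => ht i),
      Finset.prod_erase_mul _ _ hj]
  · have : (fun p : (J → Ω) × Ω => Function.update p.1 j p.2) ⁻¹' (Set.pi s t)
        = (Set.pi s t) ×ˢ Set.univ := by
      ext p
      simp only [Set.mem_preimage, Set.mem_pi, Set.mem_prod, Set.mem_univ, and_true,
        Finset.mem_coe]
      refine forall₂_congr fun i hi => ?_
      rw [Function.update_of_ne (by rintro rfl; exact hj hi)]
    rw [this, Measure.prod_prod, Measure.infinitePi_pi _ (fun i _ => ht i), measure_univ, mul_one]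

/-- It suffices to check that the cover of `T ∘ g` dominates that of `T`, composed with `g`. -/
theorem isPerfectMap_of_le {Ω' Ω : Type*} [MeasurableSpace Ω'] [MeasurableSpace Ω]
    {P : Measure Ω'} {Q : Measure Ω} [IsFiniteMeasure P] {g : Ω' → Ω} (hg : Measurable g)
    (h : ∀ T : Ω → ℝ≥0∞, cover Q T ∘ g ≤ᵐ[P] cover P (T ∘ g)) : IsPerfectMap P Q g := by
  intro T
  have h1 : cover P (T ∘ g) ≤ᵐ[P] cover Q T ∘ g :=
    cover_le_ae P _ _ ((measurable_cover Q T).comp hg)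
      (Eventually.of_forall fun ω => le_cover Q T (g ω))
  filter_upwards [h1, h T] with ω h2 h3 using le_antisymm h2 h3

/-- A perfect map remains perfect when the base space is enlarged by an independent factor. -/
theorem isPerfectMap_comp_fst {B Ω Ω' : Type*} [MeasurableSpace B] [MeasurableSpace Ω]
    [MeasurableSpace Ω'] {β : Measure B} [IsFiniteMeasure β] {Q : Measure Ω}
    (ρ : Measure Ω') [IsProbabilityMeasure ρ] {g : B → Ω} (hgm : Measurable g)
    (hg : IsPerfectMap β Q g) :
    IsPerfectMap (β.prod ρ) Q (fun p => g p.1) := by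
  refine isPerfectMap_of_le (hgm.comp measurable_fst) fun T => ?_
  -- fix the second coordinate: each section of the cover is a majorant on `B`
  have key : ∀ᵐ p ∂(ρ.prod β), cover Q T (g p.2) ≤
      cover (β.prod ρ) (T ∘ fun p => g p.1) p.swap := by
    have hms : MeasurableSet {p : Ω' × B | cover Q T (g p.2) ≤
        cover (β.prod ρ) (T ∘ fun p => g p.1) p.swap} :=
      measurableSet_le ((measurable_cover Q T).comp (hgm.comp measurable_snd))
        ((measurable_cover _ _).comp measurable_swap)
    rw [Measure.ae_prod_iff_ae_ae hms]
    refine Eventually.of_forall fun w => ?_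
    have h1 : cover β (T ∘ g) ≤ᵐ[β] fun b => cover (β.prod ρ) (T ∘ fun p => g p.1) (b, w) :=
      cover_le_ae β _ _ ((measurable_cover _ _).comp (by fun_prop))
        (Eventually.of_forall fun b =>
          le_cover (β.prod ρ) (T ∘ fun p : B × Ω' => g p.1) (b, w))
    filter_upwards [h1, hg T] with b h2 h3
    simp only [Function.comp_apply] at h3
    simpa [← h3] using h2
  exact (Measure.measurePreserving_swap (μ := β) (ν := ρ)).quasiMeasurePreserving.ae key

theorem isPerfectMap_id {Ω : Type*} [MeasurableSpace Ω] (Q : Measure Ω) :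
    IsPerfectMap Q Q id := fun T => by simp

section Select

variable {B Ω J : Type*} [MeasurableSpace B] [MeasurableSpace Ω]
  {β : Measure B}
  {ν : J → Measure Ω} [∀ j, IsProbabilityMeasure (ν j)] {Q : Measure Ω}
  {sel : B → ℕ} {e : ℕ → J}

theorem measurable_select (hsel : Measurable sel) :
    Measurable (fun p : B × (J → Ω) => p.2 (e (sel p.1))) := by
  have h : Measurable (fun q : ℕ × (J → Ω) => q.2 (e q.1)) :=
    measurable_from_prod_countable_right fun i => measurable_pi_apply (e i)
  exact h.comp ((hsel.comp measurable_fst).prodMk measurable_snd)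

/-- Selecting at random one of independent coordinates produces the mixture of their laws. -/
theorem measurePreserving_select (hsel : Measurable sel)
    (hmix : ∀ A, MeasurableSet A → ∑' i, β (sel ⁻¹' {i}) * ν (e i) A = Q A) :
    MeasurePreserving (fun p : B × (J → Ω) => p.2 (e (sel p.1)))
      (β.prod (Measure.infinitePi ν)) Q := by
  refine ⟨measurable_select hsel, Measure.ext fun A hA => ?_⟩
  rw [Measure.map_apply (measurable_select hsel) hA, ← hmix A hA]
  have : (fun p : B × (J → Ω) => p.2 (e (sel p.1))) ⁻¹' A
      = ⋃ i, (sel ⁻¹' {i}) ×ˢ (Function.eval (e i) ⁻¹' A) := by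
    ext p; simp
  rw [this, measure_iUnion]
  · refine tsum_congr fun i => ?_
    rw [Measure.prod_prod, (measurePreserving_eval_infinitePi ν (e i)).measure_preimage
      hA.nullMeasurableSet]
  · intro i j hij
    refine Set.disjoint_left.2 fun p hp hq => hij ?_
    have h1 : sel p.1 = i := hp.1
    have h2 : sel p.1 = j := hq.1
    exact h1.symm.trans h2
  · exact fun i => (hsel (measurableSet_singleton i)).prod (measurable_pi_apply (e i) hA)

/-- The random selection of one of independent coordinates is a perfect map: given all other
coordinates, the selected one has a law that is absolutely continuous with respect to `Q`. -/
theorem isPerfectMap_select [IsFiniteMeasure β] [IsFiniteMeasure Q] (hsel : Measurable sel)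
    (hmix : ∀ A, MeasurableSet A → ∑' i, β (sel ⁻¹' {i}) * ν (e i) A = Q A) :
    IsPerfectMap (β.prod (Measure.infinitePi ν)) Q
      (fun p : B × (J → Ω) => p.2 (e (sel p.1))) := by
  classical
  refine isPerfectMap_of_le (measurable_select hsel) fun T => ?_
  set g : B × (J → Ω) → Ω := fun p => p.2 (e (sel p.1)) with hg
  set H := cover (β.prod (Measure.infinitePi ν)) (T ∘ g) with hH
  have hHm : Measurable H := measurable_cover _ _
  have key : ∀ i, ∀ᵐ p ∂(β.prod (Measure.infinitePi ν)),
      sel p.1 = i → cover Q T (p.2 (e i)) ≤ H p := by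
    intro i
    have hms : MeasurableSet {p : B × (J → Ω) | sel p.1 = i → cover Q T (p.2 (e i)) ≤ H p} := by
      refine MeasurableSet.imp ?_ ?_
      · exact hsel.comp measurable_fst (measurableSet_singleton i)
      · exact measurableSet_le
          ((measurable_cover Q T).comp ((measurable_pi_apply (e i)).comp measurable_snd)) hHm
    by_cases h0 : β (sel ⁻¹' {i}) = 0
    · rw [Measure.ae_prod_iff_ae_ae hms]
      filter_upwards [measure_eq_zero_iff_ae_notMem.1 h0] with b hb
      exact Eventually.of_forall fun w hw => absurd hw hb
    have hac : ν (e i) ≪ Q := by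
      refine Measure.AbsolutelyContinuous.mk fun A hA hQA => ?_
      have := hmix A hA
      rw [hQA, ENNReal.tsum_eq_zero] at this
      exact (mul_eq_zero.1 (this i)).resolve_left h0
    -- resample the coordinate `e i`, keeping all others fixed
    have hΦ : MeasurePreserving
        (Prod.map id (fun p : (J → Ω) × Ω => Function.update p.1 (e i) p.2))
        (β.prod ((Measure.infinitePi ν).prod (ν (e i)))) (β.prod (Measure.infinitePi ν)) :=
      (MeasurePreserving.id β).prod (measurePreserving_update ν (e i))
    rw [← hΦ.map_eq, ae_map_iff hΦ.measurable.aemeasurable hms]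
    refine (Measure.ae_prod_iff_ae_ae (hΦ.measurable hms)).2 ?_
    refine Eventually.of_forall fun b => ?_
    have hms' : MeasurableSet {q : (J → Ω) × Ω | sel b = i →
        cover Q T (Function.update q.1 (e i) q.2 (e i)) ≤
          H (b, Function.update q.1 (e i) q.2)} :=
      (hΦ.measurable hms).preimage (measurable_prodMk_left (x := b))
    refine (Measure.ae_prod_iff_ae_ae hms').2 (Eventually.of_forall fun w => ?_)
    by_cases hb : sel b = i
    · have hupd : Measurable (fun x : Ω => (b, Function.update w (e i) x)) :=
        measurable_const.prodMk (measurable_update w)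
      have h1 : cover (ν (e i)) T ≤ᵐ[ν (e i)] fun x => H (b, Function.update w (e i) x) := by
        refine cover_le_ae _ _ _ (hHm.comp hupd) (Eventually.of_forall fun x => ?_)
        have := le_cover (β.prod (Measure.infinitePi ν)) (T ∘ g) (b, Function.update w (e i) x)
        simpa [hg, hb] using this
      filter_upwards [h1, cover_le_ae_of_absolutelyContinuous hac T] with x h2 h3 _
      simpa using h3.trans h2
    · exact Eventually.of_forall fun x hx => absurd hx hb
  filter_upwards [ae_all_iff.2 key] with p hp using hp _ rfl

end Select

/-! ### Assembling a representation from mixtures -/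

theorem supNorm_le_add {S : Type*} (x y z : S → ℝ) :
    supNorm (fun s => x s - z s) ≤ supNorm (fun s => x s - y s) + supNorm (fun s => y s - z s) := by
  refine iSup_le fun s => ?_
  calc ‖x s - z s‖ₑ = ‖(x s - y s) + (y s - z s)‖ₑ := by ring_nf
    _ ≤ ‖x s - y s‖ₑ + ‖y s - z s‖ₑ := enorm_add_le _ _
    _ ≤ _ := add_le_add (le_iSup (fun s => ‖x s - y s‖ₑ) s) (le_iSup (fun s => ‖y s - z s‖ₑ) s)

theorem supNorm_sub_comm {S : Type*} (x y : S → ℝ) :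
    supNorm (fun s => x s - y s) = supNorm (fun s => y s - x s) := by
  simp only [supNorm]
  exact iSup_congr fun s => by rw [← enorm_neg, neg_sub]

/-- `Q` is the mixture with weights `p i` of probability measures of which the `i`-th is carried by
the (possibly non-measurable) set `A i`. -/
def IsMixture {Ω : Type*} [MeasurableSpace Ω] (Q : Measure Ω) (p : ℕ → ℝ≥0∞) (A : ℕ → Set Ω) :
    Prop :=
  ∃ ν : ℕ → Measure Ω, (∀ i, IsProbabilityMeasure (ν i)) ∧
    (∀ B, MeasurableSet B → ∑' i, p i * ν i B = Q B) ∧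
    ∀ i, p i ≠ 0 → ∀ᵐ ω ∂ν i, ω ∈ A i

theorem isMixture_of_forall_mem {Ω : Type*} [MeasurableSpace Ω] {Q : Measure Ω}
    [IsProbabilityMeasure Q] {p : ℕ → ℝ≥0∞} (hp : ∑' i, p i = 1) {A : ℕ → Set Ω}
    (hA : ∀ i ω, ω ∈ A i) : IsMixture Q p A :=
  ⟨fun _ => Q, fun _ => inferInstance, fun B _ => by rw [ENNReal.tsum_mul_right, hp, one_mul],
    fun i _ => Eventually.of_forall (hA i)⟩

/-- Densities `ρ i` with sum `1` and masses `p i` split `Q` into a mixture. -/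
theorem isMixture_of_density {Ω : Type*} [MeasurableSpace Ω] {Q : Measure Ω}
    [IsProbabilityMeasure Q] {p : ℕ → ℝ≥0∞} {A : ℕ → Set Ω} (ρ : ℕ → Ω → ℝ≥0∞)
    (hρ : ∀ i, Measurable (ρ i)) (hsum : ∀ ω, ∑' i, ρ i ω = 1)
    (hint : ∀ i, ∫⁻ ω, ρ i ω ∂Q = p i) (hA : ∀ i ω, ρ i ω ≠ 0 → ω ∈ A i) :
    IsMixture Q p A := by
  classical
  have hpt : ∀ i, p i ≠ ∞ := fun i => by
    refine ne_of_lt (lt_of_le_of_lt (b := 1) ?_ ENNReal.one_lt_top)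
    rw [← hint i]
    calc ∫⁻ ω, ρ i ω ∂Q ≤ ∫⁻ _, 1 ∂Q :=
          lintegral_mono fun ω => (ENNReal.le_tsum i).trans (hsum ω).le
      _ = 1 := by simp
  refine ⟨fun i => if p i = 0 then Q else (p i)⁻¹ • Q.withDensity (ρ i), fun i => ?_,
    fun B hB => ?_, fun i hi => ?_⟩
  · by_cases h0 : p i = 0
    · simp only [h0, if_true]; infer_instance
    · simp only [h0, if_false]
      refine ⟨?_⟩
      rw [Measure.smul_apply, withDensity_apply _ .univ, setLIntegral_univ, hint i, smul_eq_mul,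
        ENNReal.inv_mul_cancel h0 (hpt i)]
  · have h : ∀ i, p i * (if p i = 0 then Q else (p i)⁻¹ • Q.withDensity (ρ i)) B
        = ∫⁻ ω in B, ρ i ω ∂Q := by
      intro i
      by_cases h0 : p i = 0
      · have h1 : ∫⁻ ω in B, ρ i ω ∂Q ≤ 0 := by
          rw [← h0, ← hint i]; exact setLIntegral_le_lintegral _ _
        rw [h0, zero_mul, le_antisymm h1 zero_le]
      · rw [if_neg h0, Measure.smul_apply, withDensity_apply _ hB, smul_eq_mul, ← mul_assoc,
          ENNReal.mul_inv_cancel h0 (hpt i), one_mul]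
    rw [tsum_congr h, ← lintegral_tsum fun i => (hρ i).aemeasurable]
    simp [hsum]
  · simp only [hi, if_false]
    refine Measure.ae_smul_measure ?_ _
    rw [ae_withDensity_iff (hρ i)]
    exact Eventually.of_forall (hA i)

/-- On the product of the base space `B` with one copy of `Ω` for each pair `(n, i)`, the map `g n`
picks the copy `(n, i)` with `i` the label that the base point has at level `m n`. -/
theorem exists_isRepresentation_of_isMixture {S Ω B : Type*} [MeasurableSpace Ω]
    [MeasurableSpace B] {Q : Measure Ω} [IsProbabilityMeasure Q] {Y : ℕ → Ω → S → ℝ}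
    {Z : Ω → S → ℝ} (β : Measure B) [IsProbabilityMeasure β] {g₀ : B → Ω}
    (hg₀ : MeasurePreserving g₀ β Q) (hp : IsPerfectMap β Q g₀)
    (x : ℕ → S → ℝ) {r : ℕ → ℝ≥0∞} (hr : Tendsto r atTop (𝓝 0)) (k : ℕ → ℕ)
    {sel : ℕ → B → ℕ} (hsel : ∀ m, Measurable (sel m))
    (hbad : ∑' m, β {b | k m ≤ sel m b} ≠ ∞)
    (hZ : ∀ m b, sel m b < k m → supNorm (fun s => x (sel m b) s - Z (g₀ b) s) ≤ r m)
    {m : ℕ → ℕ} (hm : Tendsto m atTop atTop)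
    (hY : ∀ n, IsMixture Q (fun i => β (sel (m n) ⁻¹' {i}))
      (fun i => {ω | i < k (m n) → supNorm (fun s => Y n ω s - x i s) ≤ r (m n)})) :
    ∃ (P : Measure (B × (ℕ × ℕ → Ω))) (g : ℕ → B × (ℕ × ℕ → Ω) → Ω),
      IsRepresentation Q Y Z P g := by
  choose ν hν hmix hA using hY
  have hνp : ∀ j : ℕ × ℕ, IsProbabilityMeasure (ν j.1 j.2) := fun j => hν _ _
  set κ := Measure.infinitePi (fun j : ℕ × ℕ => ν j.1 j.2) with hκ
  set g : ℕ → B × (ℕ × ℕ → Ω) → Ω := fun n p =>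
    if n = 0 then g₀ p.1 else p.2 (n, sel (m n) p.1) with hg
  have hg0 : g 0 = fun p => g₀ p.1 := by simp [hg]
  have hgn : ∀ n, n ≠ 0 → g n = fun p => p.2 (n, sel (m n) p.1) := fun n hn => by simp [hg, hn]
  refine ⟨β.prod κ, g, inferInstance, fun n => ?_, fun n => ?_, ?_⟩
  · rcases eq_or_ne n 0 with rfl | hn
    · rw [hg0]; exact hg₀.comp measurePreserving_fst
    · rw [hgn n hn]
      exact measurePreserving_select (ν := fun j : ℕ × ℕ => ν j.1 j.2) (e := fun i => (n, i))
        (hsel _) (hmix n)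
  · rcases eq_or_ne n 0 with rfl | hn
    · rw [hg0]; exact isPerfectMap_comp_fst _ hg₀.measurable hp
    · rw [hgn n hn]
      exact isPerfectMap_select (ν := fun j : ℕ × ℕ => ν j.1 j.2) (e := fun i => (n, i))
        (hsel _) (hmix n)
  · have hcar : ∀ n, ∀ᵐ p ∂(β.prod κ), n ≠ 0 → sel (m n) p.1 < k (m n) →
        supNorm (fun s => Y n (g n p) s - x (sel (m n) p.1) s) ≤ r (m n) := by
      intro n
      rcases eq_or_ne n 0 with rfl | hn
      · exact Eventually.of_forall fun p h => absurd rfl h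
      have : ∀ i, ∀ᵐ p ∂(β.prod κ), sel (m n) p.1 = i → i < k (m n) →
          supNorm (fun s => Y n (p.2 (n, i)) s - x i s) ≤ r (m n) := by
        intro i
        by_cases h0 : β (sel (m n) ⁻¹' {i}) = 0
        · filter_upwards [(Measure.quasiMeasurePreserving_fst (μ := β) (ν := κ)).ae
            (measure_eq_zero_iff_ae_notMem.1 h0)] with p h1 h2
          exact absurd h2 h1
        · have h1 : ∀ᵐ w ∂κ, w (n, i) ∈ {ω | i < k (m n) →
              supNorm (fun s => Y n ω s - x i s) ≤ r (m n)} :=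
            (measurePreserving_eval_infinitePi (fun j : ℕ × ℕ => ν j.1 j.2)
              (n, i)).quasiMeasurePreserving.ae (hA n i h0)
          filter_upwards [(Measure.quasiMeasurePreserving_snd (μ := β) (ν := κ)).ae h1]
            with p h2 _ using h2
      filter_upwards [ae_all_iff.2 this] with p h _
      rw [hgn n hn]
      exact h _ rfl
    -- a measurable majorant of the distance
    set h : ℕ → B × (ℕ × ℕ → Ω) → ℝ≥0∞ := fun n p =>
      if sel (m n) p.1 < k (m n) then r (m n) + r (m n) else ∞ with hh
    have hhm : ∀ n, Measurable (h n) := fun n =>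
      Measurable.ite ((hsel (m n)).comp measurable_fst (measurableSet_Iio (a := k (m n))))
        measurable_const measurable_const
    have hcov : ∀ n, ∀ᵐ p ∂(β.prod κ), n ≠ 0 → cover (β.prod κ)
        (fun p' => supNorm (fun s => Y n (g n p') s - Z (g 0 p') s)) p ≤ h n p := by
      intro n
      rcases eq_or_ne n 0 with rfl | hn
      · exact Eventually.of_forall fun p h => absurd rfl h
      refine (cover_le_ae _ _ (h n) (hhm n) ?_).mono fun p h _ => h
      filter_upwards [hcar n] with p hp
      by_cases hs : sel (m n) p.1 < k (m n)
      · simp only [hh, hs, if_true]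
        refine (supNorm_le_add _ (x (sel (m n) p.1)) _).trans (add_le_add (hp hn hs) ?_)
        rw [hg0]
        exact hZ _ _ hs
      · simp [hh, hs]
    have hBC : ∀ᵐ p ∂(β.prod κ), ∀ᶠ l in atTop, ¬ (k l ≤ sel l p.1) :=
      (Measure.quasiMeasurePreserving_fst (μ := β) (ν := κ)).ae (ae_eventually_notMem hbad)
    filter_upwards [ae_all_iff.2 hcov, hBC] with p hp hb
    have hlim : Tendsto (fun n => r (m n) + r (m n)) atTop (𝓝 0) := by
      simpa using (hr.comp hm).add (hr.comp hm)
    refine tendsto_of_tendsto_of_tendsto_of_le_of_le' tendsto_const_nhds hlim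
      (Eventually.of_forall fun _ => zero_le) ?_
    filter_upwards [hm.eventually hb, eventually_ne_atTop 0] with n h1 h2
    have := hp n h2
    simp only [hh, not_le.1 h1, if_true] at this
    exact this

/-! ### Levels of a representation -/

theorem supNorm_coe {S : Type*} (z : LInf S) : supNorm (fun s => z s) = ‖z‖ₑ := by
  refine le_antisymm (iSup_le fun s => ?_) ?_
  · rw [enorm_le_iff_norm_le]
    exact lp.norm_apply_le_norm ENNReal.top_ne_zero z s
  · by_cases hf : supNorm (fun s => z s) = ∞
    · rw [hf]; exact le_top
    · rw [← ofReal_norm, ← ENNReal.ofReal_toReal hf]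
      refine ENNReal.ofReal_le_ofReal (lp.norm_le_of_forall_le ENNReal.toReal_nonneg fun s => ?_)
      rw [← toReal_enorm]
      exact ENNReal.toReal_mono hf (le_iSup (fun s => ‖z s‖ₑ) s)

theorem supNorm_coe_sub {S : Type*} (z w : LInf S) :
    supNorm (fun s => z s - w s) = ‖z - w‖ₑ := by
  rw [← supNorm_coe]; rfl

/-- The largest of the bumps of height `1` and width `2 ε` around `x 0, …, x (k - 1)`, at `z`. It
vanishes outside `ℓ_∞(S)` when the `x i` lie in `ℓ_∞(S)`. -/
noncomputable def bumpMax {S : Type*} (ε : ℝ≥0∞) (x : ℕ → S → ℝ) (k : ℕ) (z : S → ℝ) : ℝ≥0∞ :=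
  (Finset.range k).sup fun i => min 1 (2 - supNorm (fun s => z s - x i s) / ε)

section bumpMax

variable {S : Type*} {ε : ℝ≥0∞} {x : ℕ → S → ℝ}

@[simp] theorem bumpMax_zero (z : S → ℝ) : bumpMax ε x 0 z = 0 := by simp [bumpMax]

theorem bumpMax_succ (k : ℕ) (z : S → ℝ) : bumpMax ε x (k + 1) z =
    max (min 1 (2 - supNorm (fun s => z s - x k s) / ε)) (bumpMax ε x k z) := by
  simp [bumpMax, Finset.range_add_one]

theorem bumpMax_le_one (k : ℕ) (z : S → ℝ) : bumpMax ε x k z ≤ 1 :=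
  Finset.sup_le fun _ _ => min_le_left _ _

theorem bumpMax_ne_top (k : ℕ) (z : S → ℝ) : bumpMax ε x k z ≠ ∞ :=
  ne_top_of_le_ne_top ENNReal.one_ne_top (bumpMax_le_one k z)

theorem monotone_bumpMax (z : S → ℝ) : Monotone fun k => bumpMax ε x k z :=
  fun _ _ h => Finset.sup_mono (Finset.range_mono h)

theorem bumpMax_eq_one {k i : ℕ} (hi : i < k) {z : S → ℝ} (hε : ε ≠ 0) (hε' : ε ≠ ∞)
    (h : supNorm (fun s => z s - x i s) ≤ ε) : bumpMax ε x k z = 1 := by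
  refine le_antisymm (bumpMax_le_one k z) ?_
  refine le_trans (le_min le_rfl ?_) (Finset.le_sup
    (f := fun i => min 1 (2 - supNorm (fun s => z s - x i s) / ε)) (Finset.mem_range.2 hi))
  have h1 : supNorm (fun s => z s - x i s) / ε ≤ 1 :=
    (ENNReal.div_le_iff hε hε').2 (by simpa using h)
  calc (1 : ℝ≥0∞) = 2 - 1 := by
        rw [← one_add_one_eq_two, ENNReal.add_sub_cancel_right ENNReal.one_ne_top]
    _ ≤ _ := tsub_le_tsub_left h1 2

theorem supNorm_le_of_bumpMax_lt (hε : ε ≠ 0) (hε' : ε ≠ ∞) {i : ℕ} {z : S → ℝ}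
    (h : bumpMax ε x i z < bumpMax ε x (i + 1) z) :
    supNorm (fun s => z s - x i s) ≤ 2 * ε := by
  rw [bumpMax_succ, lt_max_iff] at h
  have h1 := h.resolve_right (lt_irrefl _)
  have h2 : 0 < 2 - supNorm (fun s => z s - x i s) / ε :=
    lt_of_lt_of_le (lt_of_le_of_lt zero_le h1) (min_le_right _ _)
  rw [tsub_pos_iff_lt] at h2
  exact ((ENNReal.div_le_iff hε hε').1 h2.le)

theorem continuous_bumpMax (hε : ε ≠ 0) {x : ℕ → LInf S} (k : ℕ) :
    Continuous fun z : LInf S => bumpMax ε (fun i s => x i s) k (fun s => z s) := by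
  refine Continuous.finset_sup_apply fun i _ => continuous_const.min ?_
  simp only [supNorm_coe_sub]
  refine (ENNReal.continuous_sub_left (by norm_num)).comp ?_
  exact (ENNReal.continuous_div_const _ hε).comp (continuous_id.sub continuous_const).enorm

theorem sum_bumpMax_sub (k : ℕ) (z : S → ℝ) :
    ∑ i ∈ Finset.range k, (bumpMax ε x (i + 1) z - bumpMax ε x i z) = bumpMax ε x k z := by
  induction k with
  | zero => simp
  | succ k ih =>
    rw [Finset.sum_range_succ, ih, add_tsub_cancel_of_le (monotone_bumpMax z k.le_succ)]

end bumpMax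

/-- Convergence in law gives measurable minorants of `φ ∘ Y n` with nearly the mean of `φ ∘ Z`. -/
theorem ConvergesInLaw.eventually_exists_measurable_le {S Ω Ω' : Type*} [MeasurableSpace Ω]
    [MeasurableSpace Ω'] {Q : Measure Ω} [IsProbabilityMeasure Q] {Y : ℕ → Ω → S → ℝ}
    {ρ : Measure Ω'} [IsProbabilityMeasure ρ] {Z : Ω' → S → ℝ} (h : ConvergesInLaw Q Y ρ Z)
    {Z' : Ω' → LInf S} (hZ' : StronglyMeasurable Z') (hZ : ∀ ω s, Z' ω s = Z ω s)
    {φ : (S → ℝ) → ℝ≥0∞} (hφ : ∀ z, φ z ≤ 1)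
    (hc : Continuous fun z : LInf S => (φ fun s => z s).toReal)
    {p : ℝ≥0∞} (hp : p < ∫⁻ ω, φ (Z ω) ∂ρ) :
    ∀ᶠ n in atTop, ∃ ψ : Ω → ℝ≥0∞, Measurable ψ ∧ (∀ ω, ψ ω ≤ φ (Y n ω)) ∧
      p ≤ ∫⁻ ω, ψ ω ∂Q := by
  have hφt : ∀ z, φ z ≠ ∞ := fun z => ne_top_of_le_ne_top ENNReal.one_ne_top (hφ z)
  have hφ1 : ∀ z, (φ z).toReal ≤ 1 := fun z => by
    simpa using ENNReal.toReal_mono ENNReal.one_ne_top (hφ z)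
  have hZe : ∀ ω, Z ω = fun s => Z' ω s := fun ω => funext fun s => (hZ ω s).symm
  have hm : StronglyMeasurable fun ω => (φ (Z ω)).toReal := by
    simp only [hZe]; exact hc.comp_stronglyMeasurable hZ'
  have hi : Integrable (fun ω => (φ (Z ω)).toReal) ρ :=
    Integrable.of_bound hm.aestronglyMeasurable 1 (Eventually.of_forall fun ω => by
      rw [Real.norm_of_nonneg ENNReal.toReal_nonneg]; exact hφ1 _)
  have hint : ∫ ω, (φ (Z ω)).toReal ∂ρ = (∫⁻ ω, φ (Z ω) ∂ρ).toReal := by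
    rw [integral_eq_lintegral_of_nonneg_ae (Eventually.of_forall fun ω => ENNReal.toReal_nonneg)
      hm.aestronglyMeasurable]
    simp only [ENNReal.ofReal_toReal (hφt _)]
  have hfin : ∫⁻ ω, φ (Z ω) ∂ρ ≠ ∞ := by
    refine ne_top_of_le_ne_top ENNReal.one_ne_top ?_
    calc ∫⁻ ω, φ (Z ω) ∂ρ ≤ ∫⁻ _, 1 ∂ρ := lintegral_mono fun ω => hφ _
      _ = 1 := by simp
  have hpr : p.toReal < ∫ ω, (φ (Z ω)).toReal ∂ρ := by
    rw [hint]; exact (ENNReal.toReal_lt_toReal hp.ne_top hfin).2 hp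
  have hlim := h (fun z => 1 - (φ z).toReal) ⟨1, fun z => by
    rw [abs_of_nonneg (by linarith [hφ1 z])]; linarith [ENNReal.toReal_nonneg (a := φ z)]⟩
    (continuous_const.sub hc)
  have hlt : ∫ ω, (1 - (φ (Z ω)).toReal) ∂ρ < 1 - p.toReal := by
    rw [integral_sub (integrable_const _) hi]; simpa using hpr
  filter_upwards [hlim.eventually_lt_const hlt] with n hn
  have hne : {r | ∃ U : Ω → ℝ, Integrable U Q ∧ (∀ ω, 1 - (φ (Y n ω)).toReal ≤ U ω) ∧
      r = ∫ ω, U ω ∂Q}.Nonempty :=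
    ⟨_, fun _ => (1 : ℝ), integrable_const _,
      fun ω => by linarith [ENNReal.toReal_nonneg (a := φ (Y n ω))], rfl⟩
  obtain ⟨_, ⟨U, hU, hle, rfl⟩, hUlt⟩ := exists_lt_of_csInf_lt hne hn
  -- replace `1 - U` by a measurable version of its positive part
  obtain ⟨V, hV, hUV⟩ := hU.1
  set N := toMeasurable Q {ω | U ω ≠ V ω} with hN
  have hN0 : Q N = 0 := by rw [hN, measure_toMeasurable]; exact hUV
  set ψ : Ω → ℝ≥0∞ := Nᶜ.indicator fun ω => ENNReal.ofReal (1 - V ω) with hψ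
  have hae : ψ =ᵐ[Q] fun ω => ENNReal.ofReal (1 - U ω) := by
    filter_upwards [measure_eq_zero_iff_ae_notMem.1 hN0, hUV] with ω h1 h2
    rw [hψ, Set.indicator_of_mem (show ω ∈ Nᶜ from h1), h2]
  refine ⟨ψ, ?_, fun ω => ?_, ?_⟩
  · exact (ENNReal.measurable_ofReal.comp (measurable_const.sub hV.measurable)).indicator
      (measurableSet_toMeasurable _ _).compl
  · by_cases hω : ω ∈ N
    · rw [hψ, Set.indicator_of_notMem (by simpa using hω)]; exact zero_le
    · have hUV' : U ω = V ω := by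
        by_contra hne
        exact hω (subset_toMeasurable _ _ hne)
      rw [hψ, Set.indicator_of_mem (show ω ∈ Nᶜ from hω), ← hUV']
      rw [← ENNReal.ofReal_toReal (hφt (Y n ω))]
      exact ENNReal.ofReal_le_ofReal (by linarith [hle ω])
  · rw [lintegral_congr_ae hae]
    have h1 : p.toReal ≤ ∫ ω, max (1 - U ω) 0 ∂Q := by
      have h2 : ∫ ω, (1 - U ω) ∂Q ≤ ∫ ω, max (1 - U ω) 0 ∂Q :=
        integral_mono ((integrable_const _).sub hU) ((integrable_const _).sub hU).pos_part
          fun ω => le_max_left _ _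
      rw [integral_sub (integrable_const _) hU] at h2
      simp only [integral_const, probReal_univ, smul_eq_mul, mul_one] at h2
      linarith
    calc p = ENNReal.ofReal p.toReal := (ENNReal.ofReal_toReal hp.ne_top).symm
      _ ≤ ENNReal.ofReal (∫ ω, max (1 - U ω) 0 ∂Q) := ENNReal.ofReal_le_ofReal h1
      _ = ∫⁻ ω, ENNReal.ofReal (max (1 - U ω) 0) ∂Q :=
        ofReal_integral_eq_lintegral_ofReal ((integrable_const _).sub hU).pos_part
          (Eventually.of_forall fun ω => le_max_right _ _)
      _ = ∫⁻ ω, ENNReal.ofReal (1 - U ω) ∂Q := by simp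

/-- Weights `p i`, `i < k`, that fall short of the means of the bumps at `Z` are eventually the
masses of densities below the bumps at `Y n`. -/
theorem ConvergesInLaw.eventually_isMixture {S Ω Ω' : Type*} [MeasurableSpace Ω]
    [MeasurableSpace Ω'] {Q : Measure Ω} [IsProbabilityMeasure Q] {Y : ℕ → Ω → S → ℝ}
    {ρ : Measure Ω'} [IsProbabilityMeasure ρ] {Z : Ω' → S → ℝ} (h : ConvergesInLaw Q Y ρ Z)
    {Z' : Ω' → LInf S} (hZ' : StronglyMeasurable Z') (hZ : ∀ ω s, Z' ω s = Z ω s)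
    {ε : ℝ≥0∞} (hε : ε ≠ 0) (hε' : ε ≠ ∞) (x : ℕ → LInf S) (k : ℕ)
    {p : ℕ → ℝ≥0∞} (hp1 : ∑' i, p i = 1) (hpk : ∀ i, k < i → p i = 0)
    (hp : ∀ i, i < k → p i = 0 ∨ p i < ∫⁻ ω, (bumpMax ε (fun i s => x i s) (i + 1) (Z ω) -
      bumpMax ε (fun i s => x i s) i (Z ω)) ∂ρ) :
    ∀ᶠ n in atTop, IsMixture Q p
      (fun i => {ω | i < k → supNorm (fun s => Y n ω s - x i s) ≤ 2 * ε}) := by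
  classical
  set M : ℕ → (S → ℝ) → ℝ≥0∞ := fun i => bumpMax ε (fun i s => x i s) i with hM
  have hev : ∀ i ∈ Finset.range k, ∀ᶠ n in atTop, ∃ ψ : Ω → ℝ≥0∞, Measurable ψ ∧
      (∀ ω, ψ ω ≤ M (i + 1) (Y n ω) - M i (Y n ω)) ∧ p i ≤ ∫⁻ ω, ψ ω ∂Q := by
    intro i hi
    rcases hp i (Finset.mem_range.1 hi) with h0 | hlt
    · exact Eventually.of_forall fun n =>
        ⟨fun _ => 0, measurable_const, fun _ => zero_le, by simp [h0]⟩
    · refine h.eventually_exists_measurable_le (φ := fun z => M (i + 1) z - M i z) hZ' hZ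
        (fun z => tsub_le_self.trans (bumpMax_le_one _ _)) ?_ hlt
      have : (fun z : LInf S => (M (i + 1) (fun s => z s) - M i fun s => z s).toReal) =
          fun z : LInf S => (M (i + 1) (fun s => z s)).toReal - (M i fun s => z s).toReal := by
        funext z
        exact ENNReal.toReal_sub_of_le (monotone_bumpMax _ i.le_succ) (bumpMax_ne_top _ _)
      rw [this]
      exact (ENNReal.continuousOn_toReal.comp_continuous (continuous_bumpMax hε _)
        fun z => bumpMax_ne_top _ _).sub
        (ENNReal.continuousOn_toReal.comp_continuous (continuous_bumpMax hε _)
        fun z => bumpMax_ne_top _ _)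
  filter_upwards [(Finset.eventually_all (Finset.range k)).2 hev] with n hn
  have hn' : ∀ i, ∃ ψ : Ω → ℝ≥0∞, Measurable ψ ∧ (i < k →
      (∀ ω, ψ ω ≤ M (i + 1) (Y n ω) - M i (Y n ω)) ∧ p i ≤ ∫⁻ ω, ψ ω ∂Q) := by
    intro i
    by_cases hi : i < k
    · obtain ⟨ψ, h1, h2⟩ := hn i (Finset.mem_range.2 hi)
      exact ⟨ψ, h1, fun _ => h2⟩
    · exact ⟨fun _ => 0, measurable_const, fun h => absurd h hi⟩
  choose ψ hψm hψ using hn'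
  -- scale the minorants so that they have the prescribed masses
  set c : ℕ → ℝ≥0∞ := fun i => if p i = 0 then 0 else p i / ∫⁻ ω, ψ i ω ∂Q with hc
  have hψ1 : ∀ i, i < k → ∫⁻ ω, ψ i ω ∂Q ≤ 1 := fun i hi => by
    calc ∫⁻ ω, ψ i ω ∂Q ≤ ∫⁻ _, 1 ∂Q := lintegral_mono fun ω =>
          ((hψ i hi).1 ω).trans (tsub_le_self.trans (bumpMax_le_one _ _))
      _ = 1 := by simp
  have hc1 : ∀ i, i < k → c i ≤ 1 := fun i hi => by
    by_cases h0 : p i = 0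
    · simp [hc, h0]
    · simp only [hc, h0, if_false]
      exact ENNReal.div_le_of_le_mul (by simpa using (hψ i hi).2)
  have hcint : ∀ i, i < k → ∫⁻ ω, c i * ψ i ω ∂Q = p i := fun i hi => by
    rw [lintegral_const_mul _ (hψm i)]
    by_cases h0 : p i = 0
    · simp [hc, h0]
    · simp only [hc, h0, if_false]
      refine ENNReal.div_mul_cancel ?_ (ne_top_of_le_ne_top ENNReal.one_ne_top (hψ1 i hi))
      exact fun h' => h0 (le_antisymm (h' ▸ (hψ i hi).2) zero_le)
  have hcle : ∀ i, i < k → ∀ ω, c i * ψ i ω ≤ M (i + 1) (Y n ω) - M i (Y n ω) :=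
    fun i hi ω => (mul_le_of_le_one_left' (hc1 i hi)).trans ((hψ i hi).1 ω)
  have hsum1 : ∀ ω, ∑ i ∈ Finset.range k, c i * ψ i ω ≤ 1 := fun ω =>
    (Finset.sum_le_sum fun i hi => hcle i (Finset.mem_range.1 hi) ω).trans
      ((sum_bumpMax_sub k (Y n ω)).le.trans (bumpMax_le_one _ _))
  have hcm : Measurable fun ω => ∑ i ∈ Finset.range k, c i * ψ i ω :=
    Finset.measurable_sum _ fun i _ => (hψm i).const_mul _
  have hsumint : ∫⁻ ω, ∑ i ∈ Finset.range k, c i * ψ i ω ∂Q = ∑ i ∈ Finset.range k, p i := by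
    rw [lintegral_finsetSum _ fun i _ => (hψm i).const_mul _]
    exact Finset.sum_congr rfl fun i hi => hcint i (Finset.mem_range.1 hi)
  have hpsum : ∑ i ∈ Finset.range k, p i + p k = 1 := by
    rw [← Finset.sum_range_succ, ← hp1, eq_comm]
    exact tsum_eq_sum fun i hi => hpk i (by simpa using hi)
  have hpfin : ∑ i ∈ Finset.range k, p i ≠ ∞ :=
    ne_top_of_le_ne_top ENNReal.one_ne_top (hpsum ▸ le_self_add)
  set ρ : ℕ → Ω → ℝ≥0∞ := fun i ω => if i < k then c i * ψ i ω else
    if i = k then 1 - ∑ i ∈ Finset.range k, c i * ψ i ω else 0 with hρ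
  refine isMixture_of_density ρ (fun i => ?_) (fun ω => ?_) (fun i => ?_) fun i ω hne hi => ?_
  · simp only [hρ]
    split_ifs
    · exact (hψm i).const_mul _
    · exact measurable_const.sub hcm
    · exact measurable_const
  · rw [tsum_eq_sum (s := Finset.range (k + 1)) (fun i hi => by
      have : k < i := by simpa using hi
      simp [hρ, this.not_gt, this.ne']), Finset.sum_range_succ]
    have h1 : ∑ i ∈ Finset.range k, ρ i ω = ∑ i ∈ Finset.range k, c i * ψ i ω :=
      Finset.sum_congr rfl fun i hi => by simp [hρ, Finset.mem_range.1 hi]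
    have h2 : ρ k ω = 1 - ∑ i ∈ Finset.range k, c i * ψ i ω := by simp [hρ]
    rw [h1, h2, add_tsub_cancel_of_le (hsum1 ω)]
  · rcases lt_trichotomy i k with hi | rfl | hi
    · simp only [hρ, hi, if_true]; exact hcint i hi
    · simp only [hρ, lt_irrefl, if_false, if_true]
      rw [lintegral_sub hcm (by rw [hsumint]; exact hpfin) (Eventually.of_forall hsum1), hsumint,
        lintegral_const, measure_univ, mul_one, ← hpsum, ENNReal.add_sub_cancel_left hpfin]
    · simp [hρ, hi.not_gt, hi.ne', hpk i hi]
  · simp only [hρ, hi, if_true] at hne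
    refine supNorm_le_of_bumpMax_lt (x := fun i s => x i s) hε hε' ?_
    have := lt_of_lt_of_le (pos_iff_ne_zero.2 hne) (hcle i hi ω)
    exact tsub_pos_iff_lt.1 this

/-! ### The representation theorem -/

theorem tendsto_measure_zero_of_ae_eventually_notMem {Ω : Type*} [MeasurableSpace Ω]
    {P : Measure Ω} [IsFiniteMeasure P] {A : ℕ → Set Ω} (hA : ∀ n, MeasurableSet (A n))
    (h : ∀ᵐ ω ∂P, ∀ᶠ n in atTop, ω ∉ A n) : Tendsto (fun n => P (A n)) atTop (𝓝 0) := by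
  set B : ℕ → Set Ω := fun n => ⋃ k ≥ n, A k with hB
  have hBm : ∀ n, MeasurableSet (B n) := fun n =>
    MeasurableSet.iUnion fun k => MeasurableSet.iUnion fun _ => hA k
  have hanti : Antitone B := fun n l hnl =>
    Set.biUnion_subset_biUnion_left fun k hk => le_trans hnl hk
  have hlim := tendsto_measure_iInter_atTop (μ := P) (fun k => (hBm k).nullMeasurableSet) hanti
    ⟨0, measure_ne_top _ _⟩
  have h0 : P (⋂ n, B n) = 0 := by
    refine measure_mono_null (t := {ω | ¬ ∀ᶠ n in atTop, ω ∉ A n}) (fun ω hω hev => ?_) h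
    obtain ⟨N, hN⟩ := eventually_atTop.1 hev
    obtain ⟨k, hk, hkA⟩ := Set.mem_iUnion₂.1 (Set.mem_iInter.1 hω N)
    exact hN k hk hkA
  rw [h0] at hlim
  exact tendsto_of_tendsto_of_tendsto_of_le_of_le tendsto_const_nhds hlim (fun _ => zero_le)
    fun n => measure_mono (Set.subset_iUnion₂_of_subset n le_rfl subset_rfl)

/-- A random variable with separable range lies close to finitely many points with probability
close to one. -/
theorem exists_measure_forall_lt_le {S Ω : Type*} [MeasurableSpace Ω] {Q : Measure Ω}
    [IsProbabilityMeasure Q] {Z : Ω → LInf S} (hZ : StronglyMeasurable Z) :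
    ∃ x : ℕ → LInf S, ∀ ε : ℝ≥0∞, ε ≠ 0 → ∃ K : ℕ,
      Q {ω | ∀ i < K, ε < ‖Z ω - x i‖ₑ} ≤ ε := by
  obtain ⟨c, hc, hcl⟩ := hZ.isSeparable_range
  obtain ⟨ω₀⟩ : Nonempty Ω := Measure.nonempty_of_neZero Q
  have hne : c.Nonempty := closure_nonempty_iff.1 ⟨Z ω₀, hcl ⟨ω₀, rfl⟩⟩
  obtain ⟨x, rfl⟩ := hc.exists_eq_range hne
  refine ⟨x, fun ε hε => ?_⟩
  set A : ℕ → Set Ω := fun K => {ω | ∀ i < K, ε < ‖Z ω - x i‖ₑ} with hA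
  have hAm : ∀ K, MeasurableSet (A K) := fun K => by
    have : A K = ⋂ i, ⋂ (_ : i < K), {ω | ε < ‖Z ω - x i‖ₑ} := by ext; simp [hA]
    rw [this]
    exact MeasurableSet.iInter fun i => MeasurableSet.iInter fun _ =>
      measurableSet_lt measurable_const (hZ.sub stronglyMeasurable_const).enorm
  have hlim := tendsto_measure_zero_of_ae_eventually_notMem (P := Q) hAm
    (Eventually.of_forall fun ω => by
      obtain ⟨_, ⟨i, rfl⟩, hi⟩ := EMetric.mem_closure_iff.1 (hcl ⟨ω, rfl⟩) ε (pos_iff_ne_zero.2 hε)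
      rw [edist_eq_enorm_sub] at hi
      filter_upwards [eventually_gt_atTop i] with K hK hω
      exact absurd (hω i hK) hi.not_gt)
  obtain ⟨K, hK⟩ := (hlim.eventually (gt_mem_nhds (pos_iff_ne_zero.2 hε))).exists
  exact ⟨K, hK.le⟩

/-- If each `C m` holds eventually and `C 0` always, then `C (m n) n` for some `m n → ∞`. -/
theorem exists_tendsto_atTop_forall {C : ℕ → ℕ → Prop} (h0 : ∀ n, C 0 n)
    (h : ∀ m, ∀ᶠ n in atTop, C m n) :
    ∃ m : ℕ → ℕ, Tendsto m atTop atTop ∧ ∀ n, C (m n) n := by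
  classical
  refine ⟨fun n => Nat.findGreatest (fun m => C m n) n, tendsto_atTop.2 fun M => ?_, fun n =>
    Nat.findGreatest_spec (P := fun m => C m n) (Nat.zero_le n) (h0 n)⟩
  filter_upwards [h M, eventually_ge_atTop M] with n h1 h2
  exact Nat.le_findGreatest h2 h1

theorem volume_restrict_Icc_setOf_le {c d : ℝ≥0∞} (hcd : c ≤ d) (hd : d ≠ ∞) :
    volume.restrict (Set.Icc (0 : ℝ) 1) {y | c ≤ ENNReal.ofReal y ∧ ENNReal.ofReal y < d}
      ≤ d - c := by
  have hc : c ≠ ∞ := ne_top_of_le_ne_top hd hcd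
  calc _ ≤ volume.restrict (Set.Icc (0 : ℝ) 1) (Set.Ico c.toReal d.toReal ∪ Set.Iio 0) := by
        refine measure_mono fun y hy => ?_
        rcases lt_or_ge y 0 with h0 | h0
        · exact Or.inr h0
        · exact Or.inl ⟨ENNReal.toReal_le_of_le_ofReal h0 hy.1,
            (ENNReal.ofReal_lt_iff_lt_toReal h0 hd).1 hy.2⟩
    _ ≤ volume.restrict (Set.Icc (0 : ℝ) 1) (Set.Ico c.toReal d.toReal)
        + volume.restrict (Set.Icc (0 : ℝ) 1) (Set.Iio 0) := measure_union_le _ _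
    _ ≤ volume (Set.Ico c.toReal d.toReal) + 0 := by
        refine add_le_add (Measure.restrict_apply_le _ _) (le_of_eq ?_)
        rw [Measure.restrict_apply measurableSet_Iio]
        convert measure_empty (μ := (volume : Measure ℝ))
        ext y
        simp only [Set.mem_inter_iff, Set.mem_Iio, Set.mem_Icc, Set.mem_empty_iff_false, iff_false]
        rintro ⟨h1, h2, -⟩
        exact absurd h1 h2.not_gt
    _ = d - c := by
        rw [add_zero, Real.volume_Ico, ENNReal.ofReal_sub _ ENNReal.toReal_nonneg,
          ENNReal.ofReal_toReal hc, ENNReal.ofReal_toReal hd]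

section Label

variable {S Ω : Type*}

open Classical in
/-- The label of `(ω, ζ)`: the first `i < k` at which the maximum of the bumps, scaled by `1 - ε`,
exceeds `ζ` at `Z ω`, and `k` if there is none. -/
noncomputable def label (ε : ℝ≥0∞) (x : ℕ → S → ℝ) (k : ℕ) (Z : Ω → S → ℝ) (b : Ω × ℝ) : ℕ :=
  Nat.find (p := fun i => k ≤ i ∨ ENNReal.ofReal b.2 < (1 - ε) * bumpMax ε x (i + 1) (Z b.1))
    ⟨k, Or.inl le_rfl⟩

variable {ε : ℝ≥0∞} {x : ℕ → S → ℝ} {k : ℕ} {Z : Ω → S → ℝ}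

theorem label_le (b : Ω × ℝ) : label ε x k Z b ≤ k := Nat.find_le (Or.inl le_rfl)

theorem measurable_label [MeasurableSpace Ω] (h : ∀ i, Measurable fun ω => bumpMax ε x i (Z ω)) :
    Measurable (label ε x k Z) := by
  classical
  refine measurable_find _ fun i => (MeasurableSet.const (k ≤ i)).union ?_
  exact measurableSet_lt (ENNReal.measurable_ofReal.comp measurable_snd)
    (((h (i + 1)).comp measurable_fst).const_mul _)

theorem le_ofReal_of_le_label {b : Ω × ℝ} {i : ℕ} (hi : i ≤ label ε x k Z b) :
    (1 - ε) * bumpMax ε x i (Z b.1) ≤ ENNReal.ofReal b.2 := by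
  rcases i with _ | i
  · simp
  · have := Nat.find_min _ (Nat.lt_of_succ_le hi)
    exact not_lt.1 fun h => this (Or.inr h)

theorem ofReal_lt_of_label_lt {b : Ω × ℝ} (hi : label ε x k Z b < k) :
    ENNReal.ofReal b.2 < (1 - ε) * bumpMax ε x (label ε x k Z b + 1) (Z b.1) := by
  have h : k ≤ label ε x k Z b ∨ _ := Nat.find_spec (p := fun i => k ≤ i ∨ ENNReal.ofReal b.2 <
    (1 - ε) * bumpMax ε x (i + 1) (Z b.1)) ⟨k, Or.inl le_rfl⟩
  exact h.resolve_left hi.not_ge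

theorem supNorm_le_of_label_lt (hε : ε ≠ 0) (hε' : ε ≠ ∞) {b : Ω × ℝ}
    (hi : label ε x k Z b < k) :
    supNorm (fun s => x (label ε x k Z b) s - Z b.1 s) ≤ 2 * ε := by
  rw [supNorm_sub_comm]
  refine supNorm_le_of_bumpMax_lt hε hε' ?_
  exact lt_of_mul_lt_mul_left' ((le_ofReal_of_le_label le_rfl).trans_lt (ofReal_lt_of_label_lt hi))

/-- A label `i < k` has a probability smaller than the mean of the `i`-th bump, or zero. -/
theorem measure_label_lt [MeasurableSpace Ω] (Q : Measure Ω) [IsProbabilityMeasure Q] (hε : ε ≠ 0)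
    (h : ∀ i, Measurable fun ω => bumpMax ε x i (Z ω)) {i : ℕ} (hi : i < k) :
    (Q.prod (volume.restrict (Set.Icc (0 : ℝ) 1))) (label ε x k Z ⁻¹' {i}) = 0 ∨
    (Q.prod (volume.restrict (Set.Icc (0 : ℝ) 1))) (label ε x k Z ⁻¹' {i}) <
      ∫⁻ ω, (bumpMax ε x (i + 1) (Z ω) - bumpMax ε x i (Z ω)) ∂Q := by
  set I := ∫⁻ ω, (bumpMax ε x (i + 1) (Z ω) - bumpMax ε x i (Z ω)) ∂Q with hI
  have hle : (Q.prod (volume.restrict (Set.Icc (0 : ℝ) 1))) (label ε x k Z ⁻¹' {i}) ≤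
      (1 - ε) * I := by
    rw [Measure.prod_apply (measurable_label h (measurableSet_singleton i)), hI,
      ← lintegral_const_mul _ (f := fun ω => bumpMax ε x (i + 1) (Z ω) - bumpMax ε x i (Z ω))
        ((h (i + 1)).sub (h i))]
    refine lintegral_mono fun ω => ?_
    rw [ENNReal.mul_sub fun _ _ => ne_top_of_le_ne_top ENNReal.one_ne_top tsub_le_self]
    refine (measure_mono fun y hy => ?_).trans
      (volume_restrict_Icc_setOf_le (mul_le_mul_right (monotone_bumpMax (Z ω) i.le_succ) _)
        (ENNReal.mul_ne_top (ne_top_of_le_ne_top ENNReal.one_ne_top tsub_le_self)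
          (bumpMax_ne_top _ _)))
    have hy' : label ε x k Z (ω, y) = i := hy
    refine ⟨le_ofReal_of_le_label (b := (ω, y)) hy'.ge, ?_⟩
    have := ofReal_lt_of_label_lt (b := (ω, y)) (by rw [hy']; exact hi)
    rwa [hy'] at this
  have hIfin : I ≠ ∞ := by
    refine ne_top_of_le_ne_top ENNReal.one_ne_top ?_
    calc I ≤ ∫⁻ _, 1 ∂Q := lintegral_mono fun ω => tsub_le_self.trans (bumpMax_le_one _ _)
      _ = 1 := by simp
  by_cases h0 : I = 0
  · left; rw [h0, mul_zero] at hle; exact le_antisymm hle zero_le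
  · right
    refine hle.trans_lt ?_
    conv_rhs => rw [← one_mul I]
    refine ENNReal.mul_lt_mul_left h0 hIfin ?_
    exact ENNReal.sub_lt_self ENNReal.one_ne_top one_ne_zero hε

/-- The label `k` is assigned with small probability. -/
theorem measure_le_label [MeasurableSpace Ω] (Q : Measure Ω) [IsProbabilityMeasure Q]
    (hε : ε ≠ 0) (hε1 : ε ≤ 1)
    {δ : ℝ≥0∞} (hδ : Q {ω | ∀ i < k, ε < supNorm (fun s => Z ω s - x i s)} ≤ δ) :
    (Q.prod (volume.restrict (Set.Icc (0 : ℝ) 1))) {b | k ≤ label ε x k Z b} ≤ δ + ε := by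
  have hε' : ε ≠ ∞ := ne_top_of_le_ne_top ENNReal.one_ne_top hε1
  calc _ ≤ (Q.prod (volume.restrict (Set.Icc (0 : ℝ) 1)))
        ({ω | ∀ i < k, ε < supNorm (fun s => Z ω s - x i s)} ×ˢ Set.univ ∪
          Set.univ ×ˢ {y | 1 - ε ≤ ENNReal.ofReal y}) := by
        refine measure_mono fun b hb => ?_
        by_cases hω : ∀ i < k, ε < supNorm (fun s => Z b.1 s - x i s)
        · exact Or.inl ⟨hω, trivial⟩
        · push Not at hω
          obtain ⟨i, hi, hle⟩ := hω
          have := le_ofReal_of_le_label (b := b) hb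
          rw [bumpMax_eq_one hi hε hε' hle, mul_one] at this
          exact Or.inr ⟨trivial, this⟩
    _ ≤ _ := (measure_union_le _ _).trans ?_
  rw [Measure.prod_prod, Measure.prod_prod, measure_univ (μ := Q), one_mul]
  refine add_le_add ((mul_le_of_le_one_right' ?_).trans hδ) ?_
  · simp
  · rw [Measure.restrict_apply (measurableSet_le measurable_const ENNReal.measurable_ofReal)]
    have hsub : {y : ℝ | 1 - ε ≤ ENNReal.ofReal y} ∩ Set.Icc 0 1 ⊆
        Set.Icc (1 - ε).toReal 1 := fun y hy =>
      ⟨ENNReal.toReal_le_of_le_ofReal hy.2.1 hy.1, hy.2.2⟩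
    refine (measure_mono hsub).trans ?_
    rw [Real.volume_Icc, ENNReal.ofReal_sub _ ENNReal.toReal_nonneg, ENNReal.ofReal_one,
      ENNReal.ofReal_toReal (ne_top_of_le_ne_top ENNReal.one_ne_top tsub_le_self),
      ENNReal.sub_sub_cancel ENNReal.one_ne_top hε1]

end Label

/-- Convergence in law to a limit with separable range is realized by perfect maps. -/
theorem ConvergesInLaw.exists_isRepresentation {S : Type*} {Ω : Type u} [MeasurableSpace Ω]
    {Q : Measure Ω} [IsProbabilityMeasure Q] {Y : ℕ → Ω → S → ℝ} {Z : Ω → S → ℝ}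
    (h : ConvergesInLaw Q Y Q Z) {Z' : Ω → LInf S} (hZ' : StronglyMeasurable Z')
    (hZ : ∀ ω s, Z' ω s = Z ω s) :
    ∃ (Ωh : Type u) (_ : MeasurableSpace Ωh) (P : Measure Ωh) (g : ℕ → Ωh → Ω),
      IsRepresentation Q Y Z P g := by
  have hZe : ∀ ω, Z ω = fun s => Z' ω s := fun ω => funext fun s => (hZ ω s).symm
  obtain ⟨x, hx⟩ := exists_measure_forall_lt_le (Q := Q) hZ'
  set ε : ℕ → ℝ≥0∞ := fun m => 2⁻¹ ^ m with hε
  have hε0 : ∀ m, ε m ≠ 0 := fun m => pow_ne_zero _ (by simp)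
  have hε1 : ∀ m, ε m ≤ 1 := fun m => pow_le_one' (by simp) m
  have hεt : ∀ m, ε m ≠ ∞ := fun m => ne_top_of_le_ne_top ENNReal.one_ne_top (hε1 m)
  have hεsum : ∑' m, ε m = 2 := by
    simp only [hε]; rw [ENNReal.tsum_geometric, ENNReal.one_sub_inv_two, inv_inv]
  -- level `0` has no centres, so that it is available for every `n`
  have hK : ∀ m, ∃ K : ℕ, Q {ω | ∀ i < K, ε m < ‖Z' ω - x i‖ₑ} ≤ ε m ∧ (m = 0 → K = 0) := by
    intro m
    rcases eq_or_ne m 0 with rfl | hm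
    · exact ⟨0, by simp [hε], fun _ => rfl⟩
    · obtain ⟨K, hK⟩ := hx (ε m) (hε0 m)
      exact ⟨K, hK, fun h => absurd h hm⟩
  choose k hk hk0 using hK
  set X : ℕ → S → ℝ := fun i s => x i s with hX
  have hbm : ∀ m i, Measurable fun ω => bumpMax (ε m) X i (Z ω) := fun m i => by
    simp only [hZe]
    exact ((continuous_bumpMax (hε0 m) i).comp_stronglyMeasurable hZ').measurable
  have hprob : IsProbabilityMeasure (volume.restrict (Set.Icc (0 : ℝ) 1)) := ⟨by simp⟩
  set β := Q.prod (volume.restrict (Set.Icc (0 : ℝ) 1)) with hβ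
  set sel : ℕ → Ω × ℝ → ℕ := fun m => label (ε m) X (k m) Z with hsel
  have hselm : ∀ m, Measurable (sel m) := fun m => measurable_label (hbm m)
  have hsum : ∀ m, ∑' i, β (sel m ⁻¹' {i}) = 1 := fun m => by
    have := tsum_measure_preimage_singleton (μ := β) (f := sel m) Set.countable_univ
      fun i _ => hselm m (measurableSet_singleton i)
    rw [tsum_univ (f := fun i => β (sel m ⁻¹' {i}))] at this
    simpa using this
  obtain ⟨m, hm, hC⟩ := exists_tendsto_atTop_forall
    (C := fun m n => IsMixture Q (fun i => β (sel m ⁻¹' {i}))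
      (fun i => {ω | i < k m → supNorm (fun s => Y n ω s - X i s) ≤ 2 * ε m}))
    (fun n => isMixture_of_forall_mem (hsum 0) fun i ω hi => by simp [hk0 0 rfl] at hi)
    (fun m => h.eventually_isMixture hZ' hZ (hε0 m) (hεt m) x (k m) (hsum m)
      (fun i hi => by
        have : sel m ⁻¹' {i} = ∅ := Set.eq_empty_of_forall_notMem fun b hb =>
          (label_le (ε := ε m) (x := X) (k := k m) (Z := Z) b).not_gt (hi.trans_eq (Eq.symm hb))
        rw [this, measure_empty])
      fun i hi => measure_label_lt Q (hε0 m) (hbm m) hi)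
  have hr : Tendsto (fun m => 2 * ε m) atTop (𝓝 0) := by
    have := ENNReal.Tendsto.const_mul (a := 2)
      (ENNReal.tendsto_pow_atTop_nhds_zero_of_lt_one (r := 2⁻¹) (by simp)) (Or.inr (by simp))
    simpa using this
  have hbad : ∑' m, β {b | k m ≤ sel m b} ≠ ∞ := by
    refine ne_top_of_le_ne_top ?_ (ENNReal.tsum_le_tsum fun m =>
      measure_le_label (δ := ε m) Q (hε0 m) (hε1 m) ?_)
    · rw [ENNReal.tsum_add, hεsum]; norm_num
    · simpa only [hZe, hX, supNorm_coe_sub] using hk m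
  obtain ⟨P, g, hg⟩ := exists_isRepresentation_of_isMixture (Y := Y) (Z := Z) β
    (g₀ := fun b : Ω × ℝ => b.1) measurePreserving_fst
    (isPerfectMap_comp_fst _ measurable_id (isPerfectMap_id Q)) X hr k hselm hbad
    (fun m b hb => supNorm_le_of_label_lt (hε0 m) (hεt m) hb) hm hC
  exact ⟨_, _, P, g, hg⟩

/-! ### Convergence in law from convergence in outer probability -/

theorem abs_upperExp_sub_integral_le {Ω : Type*} [MeasurableSpace Ω] {μ : Measure Ω}
    {h g b : Ω → ℝ} (hg : Integrable g μ) (hb : Integrable b μ)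
    (hle : ∀ ω, |h ω - g ω| ≤ b ω) : |upperExp μ h - ∫ ω, g ω ∂μ| ≤ ∫ ω, b ω ∂μ := by
  have hlow : ∀ r ∈ {r | ∃ U : Ω → ℝ, Integrable U μ ∧ (∀ ω, h ω ≤ U ω) ∧ r = ∫ ω, U ω ∂μ},
      ∫ ω, g ω ∂μ - ∫ ω, b ω ∂μ ≤ r := by
    rintro r ⟨U, hU, hhU, rfl⟩
    rw [← integral_sub hg hb]
    exact integral_mono (hg.sub hb) hU fun ω => by
      have := (abs_le.1 (hle ω)).1
      have := hhU ω
      linarith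
  have hmem : ∫ ω, (g ω + b ω) ∂μ ∈
      {r | ∃ U : Ω → ℝ, Integrable U μ ∧ (∀ ω, h ω ≤ U ω) ∧ r = ∫ ω, U ω ∂μ} :=
    ⟨fun ω => g ω + b ω, hg.add hb, fun ω => by linarith [(abs_le.1 (hle ω)).2], rfl⟩
  have h1 : ∫ ω, g ω ∂μ - ∫ ω, b ω ∂μ ≤ upperExp μ h := le_csInf ⟨_, hmem⟩ hlow
  have h2 : upperExp μ h ≤ ∫ ω, (g ω + b ω) ∂μ := csInf_le ⟨_, hlow⟩ hmem
  rw [integral_add hg hb] at h2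
  exact abs_le.2 ⟨by linarith, by linarith⟩

theorem exists_lInf_coe_eq {S : Type*} {y : S → ℝ} (w : LInf S)
    (h : supNorm (fun s => y s - w s) ≠ ∞) : ∃ z : LInf S, ∀ s, z s = y s := by
  have hmem : Memℓp (fun s => y s - w s) ∞ := by
    refine memℓp_infty ⟨(supNorm fun s => y s - w s).toReal, ?_⟩
    rintro _ ⟨s, rfl⟩
    simp only
    rw [← toReal_enorm]
    exact ENNReal.toReal_mono h (le_iSup (fun s => ‖y s - w s‖ₑ) s)
  refine ⟨(⟨fun s => y s - w s, hmem⟩ : LInf S) + w, fun s => ?_⟩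
  rw [lp.coeFn_add, Pi.add_apply]
  change y s - w s + w s = y s
  ring

/-- The points at which a continuous function oscillates by at most `η` within distance `δ` form a
closed set, and these sets exhaust the space as `δ` decreases; this replaces uniform continuity. -/
theorem isClosed_setOf_forall_dist_le {V : Type*} [PseudoMetricSpace V] {H : V → ℝ}
    (hH : Continuous H) (δ η : ℝ) :
    IsClosed {z : V | ∀ y, dist y z < δ → |H y - H z| ≤ η} := by
  rw [← isSeqClosed_iff_isClosed]
  intro u z hu hz y hy
  have h1 : Tendsto (fun n => |H y - H (u n)|) atTop (𝓝 |H y - H z|) :=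
    (tendsto_const_nhds.sub ((hH.tendsto z).comp hz)).abs
  have h2 : Tendsto (fun n => dist y (u n)) atTop (𝓝 (dist y z)) :=
    tendsto_const_nhds.dist hz
  refine le_of_tendsto h1 ?_
  filter_upwards [h2.eventually_lt_const hy] with n hn using hu n y hn

/-- Convergence in outer probability implies convergence in law. For a continuous `H`, the event
that `Z` lies where `H` oscillates little within distance `δ` has probability close to one, and on
it `H (Y n)` is close to `H Z` as soon as `Y n` is within `δ` of `Z`. -/
theorem convergesInLaw_of_tendsto_cover {S Ω : Type*} [MeasurableSpace Ω] {P : Measure Ω}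
    [IsProbabilityMeasure P] {Y : ℕ → Ω → S → ℝ} {Z : Ω → S → ℝ} {Z' : Ω → LInf S}
    (hZ' : StronglyMeasurable Z') (hZ : ∀ ω s, Z' ω s = Z ω s)
    (h : ∀ ε : ℝ, 0 < ε → Tendsto (fun n => P {ω | ENNReal.ofReal ε <
      cover P (fun ω' => supNorm fun s => Y n ω' s - Z ω' s) ω}) atTop (𝓝 0)) :
    ConvergesInLaw P Y P Z := by
  intro H ⟨C, hC⟩ hH
  borelize (LInf S)
  have hZe : ∀ ω, Z ω = fun s => Z' ω s := fun ω => funext fun s => (hZ ω s).symm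
  set H' : LInf S → ℝ := fun z => H fun s => z s with hH'
  have hC0 : 0 ≤ C := (abs_nonneg _).trans (hC 0)
  have hint : Integrable (fun ω => H (Z ω)) P := by
    refine Integrable.of_bound ?_ C (Eventually.of_forall fun ω => hC _)
    simp only [hZe]
    exact (hH.comp_stronglyMeasurable hZ').aestronglyMeasurable
  rw [Metric.tendsto_atTop']
  intro η₀ hη₀
  obtain ⟨η, hη, hηlt⟩ : ∃ η > 0, η * (1 + 4 * C) < η₀ :=
    ⟨η₀ / (2 * (1 + 4 * C)), by positivity, by
      rw [div_mul_eq_mul_div, div_lt_iff₀ (by positivity)]; nlinarith⟩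
  set U : ℕ → Set (LInf S) := fun k =>
    {z | ∀ y, dist y z < 1 / ((k : ℝ) + 1) → |H' y - H' z| ≤ η} with hU
  set A : ℕ → Set Ω := fun k => {ω | Z' ω ∉ U k} with hA
  have hAm : ∀ k, MeasurableSet (A k) := fun k =>
    (hZ'.measurable (isClosed_setOf_forall_dist_le hH _ _).measurableSet).compl
  have hlim := tendsto_measure_zero_of_ae_eventually_notMem (P := P) hAm
    (Eventually.of_forall fun ω => by
      obtain ⟨δ, hδ, hδ'⟩ := Metric.continuous_iff.1 hH (Z' ω) η hη
      obtain ⟨N, hN⟩ := exists_nat_one_div_lt hδ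
      filter_upwards [eventually_ge_atTop N] with k hk hω
      refine hω fun y hy => (hδ' y (hy.trans (lt_of_le_of_lt ?_ hN))).le
      exact one_div_le_one_div_of_le (by positivity) (by exact_mod_cast Nat.succ_le_succ hk))
  have hηe : (0 : ℝ≥0∞) < ENNReal.ofReal η := ENNReal.ofReal_pos.2 hη
  obtain ⟨k, hk⟩ := (hlim.eventually (gt_mem_nhds hηe)).exists
  set δ : ℝ := 1 / ((k : ℝ) + 1) / 2 with hδ
  have hδ0 : 0 < δ := by positivity
  obtain ⟨N, hN⟩ := eventually_atTop.1 ((h δ hδ0).eventually (gt_mem_nhds hηe))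
  refine ⟨N, fun n hn => ?_⟩
  set D := cover P (fun ω' => supNorm fun s => Y n ω' s - Z ω' s) with hD
  set B : Set Ω := {ω | ENNReal.ofReal δ < D ω} ∪ A k with hB
  have hBm : MeasurableSet B :=
    (measurableSet_lt measurable_const (measurable_cover _ _)).union (hAm k)
  have hPB : P.real B ≤ η + η := by
    refine (measureReal_union_le _ _).trans (add_le_add ?_ ?_)
    · exact ENNReal.toReal_le_of_le_ofReal hη.le (hN n hn.le).le
    · exact ENNReal.toReal_le_of_le_ofReal hη.le hk.le
  have hb : Integrable (fun ω => η + B.indicator (fun _ => 2 * C) ω) P :=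
    (integrable_const _).add ((integrable_const _).indicator hBm)
  have hmain : ∀ ω, |H (Y n ω) - H (Z ω)| ≤ η + B.indicator (fun _ => 2 * C) ω := by
    intro ω
    by_cases hω : ω ∈ B
    · rw [Set.indicator_of_mem hω]
      have := abs_sub (H (Y n ω)) (H (Z ω))
      linarith [hC (Y n ω), hC (Z ω)]
    · rw [Set.indicator_of_notMem hω, add_zero]
      have h1 : D ω ≤ ENNReal.ofReal δ := not_lt.1 fun h => hω (Or.inl h)
      have h2 : Z' ω ∈ U k := by
        by_contra h; exact hω (Or.inr h)
      have h3 : supNorm (fun s => Y n ω s - Z' ω s) ≤ ENNReal.ofReal δ := by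
        have := le_cover P (fun ω' => supNorm fun s => Y n ω' s - Z ω' s) ω
        simp only [hZe] at this
        exact this.trans (by simpa only [hD, hZe] using h1)
      obtain ⟨y, hy⟩ := exists_lInf_coe_eq (Z' ω) (ne_top_of_le_ne_top ENNReal.ofReal_ne_top h3)
      have hye : Y n ω = fun s => y s := funext fun s => (hy s).symm
      rw [hye, supNorm_coe_sub, ← ofReal_norm, ENNReal.ofReal_le_ofReal_iff hδ0.le] at h3
      rw [hye, hZe]
      refine h2 y ?_
      rw [dist_eq_norm]
      have : δ < 1 / ((k : ℝ) + 1) := half_lt_self (by positivity)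
      linarith
  rw [Real.dist_eq]
  refine (abs_upperExp_sub_integral_le hint hb hmain).trans_lt ?_
  rw [integral_add (integrable_const _) ((integrable_const _).indicator hBm),
    integral_indicator_const _ hBm]
  simp only [integral_const, probReal_univ, smul_eq_mul, one_mul]
  nlinarith

/-! ### Uniform continuity of the paths of the limit process -/

/-- A strongly measurable function whose averages over sets of positive measure belong to a closed
set takes almost all its values in it. -/
theorem ae_mem_of_isClosed_of_setAverage_mem {V Ω : Type*} [NormedAddCommGroup V]
    [NormedSpace ℝ V] [CompleteSpace V] [MeasurableSpace Ω] {P : Measure Ω} [IsFiniteMeasure P]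
    {G : Ω → V} (hG : StronglyMeasurable G) {K : Set V} (hK : IsClosed K)
    (h : ∀ A, MeasurableSet A → P A ≠ 0 → IntegrableOn G A P → (⨍ ω in A, G ω ∂P) ∈ K) :
    ∀ᵐ ω ∂P, G ω ∈ K := by
  borelize V
  obtain ⟨c, hc, hcl⟩ := hG.isSeparable_range
  have hnull : ∀ x ∈ c, ∀ j : ℕ, Disjoint (Metric.closedBall x (1 / ((j : ℝ) + 1))) K →
      ∀ᵐ ω ∂P, G ω ∉ Metric.closedBall x (1 / ((j : ℝ) + 1)) := by
    intro x _ j hd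
    set A := G ⁻¹' Metric.closedBall x (1 / ((j : ℝ) + 1)) with hA
    have hAm : MeasurableSet A := hG.measurable Metric.isClosed_closedBall.measurableSet
    suffices h' : P A = 0 from measure_eq_zero_iff_ae_notMem.1 h'
    by_contra h0
    have hmem : ∀ᵐ ω ∂P.restrict A, G ω ∈ Metric.closedBall x (1 / ((j : ℝ) + 1)) :=
      ae_restrict_mem hAm
    have hi : IntegrableOn G A P := by
      refine Integrable.of_bound hG.aestronglyMeasurable (‖x‖ + 1 / ((j : ℝ) + 1)) ?_
      filter_upwards [hmem] with ω hω
      rw [mem_closedBall_iff_norm] at hω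
      linarith [norm_le_norm_add_norm_sub' (G ω) x]
    exact Set.disjoint_left.1 hd ((convex_closedBall x _).set_average_mem
      Metric.isClosed_closedBall h0 (measure_ne_top _ _) hmem hi) (h A hAm h0 hi)
  have hall : ∀ᵐ ω ∂P, ∀ x ∈ c, ∀ j : ℕ,
      Disjoint (Metric.closedBall x (1 / ((j : ℝ) + 1))) K →
        G ω ∉ Metric.closedBall x (1 / ((j : ℝ) + 1)) := by
    rw [ae_ball_iff hc]
    intro x hx
    rw [ae_all_iff]
    intro j
    by_cases hd : Disjoint (Metric.closedBall x (1 / ((j : ℝ) + 1))) K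
    · filter_upwards [hnull x hx j hd] with ω hω _ using hω
    · exact Eventually.of_forall fun ω hd' => absurd hd' hd
  filter_upwards [hall] with ω hω
  by_contra hGK
  obtain ⟨r, hr, hball⟩ := Metric.isOpen_iff.1 hK.isOpen_compl (G ω) hGK
  obtain ⟨j, hj⟩ := exists_nat_one_div_lt (half_pos hr)
  have hj0 : 0 < 1 / ((j : ℝ) + 1) := by positivity
  obtain ⟨x, hx, hxd⟩ := Metric.mem_closure_iff.1 (hcl ⟨ω, rfl⟩) _ hj0
  refine hω x hx j (Set.disjoint_left.2 fun y hy hyK => ?_) hxd.le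
  refine hball ?_ hyK
  rw [Metric.mem_closedBall] at hy
  rw [Metric.mem_ball]
  have := dist_triangle y x (G ω)
  rw [dist_comm x] at this
  linarith

theorem abs_coe_sub_coe_le {T : Type*} (z w : LInf T) (t : T) : |z t - w t| ≤ ‖z - w‖ :=
  lp.norm_apply_le_norm ENNReal.top_ne_zero (z - w) t

theorem isClosed_setOf_uniformlyContinuous {T : Type*} (ρ : T → T → ℝ) :
    IsClosed {z : LInf T | ∀ ε > 0, ∃ δ > 0, ∀ p q, ρ p q ≤ δ → |z p - z q| ≤ ε} := by
  refine isClosed_of_closure_subset fun z hz ε hε => ?_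
  obtain ⟨w, hw, hzw⟩ := Metric.mem_closure_iff.1 hz (ε / 3) (by positivity)
  obtain ⟨δ, hδ, h⟩ := hw (ε / 3) (by positivity)
  refine ⟨δ, hδ, fun p q hpq => ?_⟩
  rw [dist_eq_norm] at hzw
  have h1 := abs_le.1 (h p q hpq)
  have h2 := abs_le.1 (abs_coe_sub_coe_le z w p)
  have h3 := abs_le.1 (abs_coe_sub_coe_le z w q)
  exact abs_le.2 ⟨by linarith [h1.1, h2.1, h3.2], by linarith [h1.2, h2.2, h3.1]⟩

/-- Almost all paths of a process with a Radon law in `ℓ_∞(T)` and second moments are uniformly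
continuous for the `L²` distance: the averages of the process over an event are, since
`|E[1_A (G p - G q)]|` is at most the `L²` distance of `G p` and `G q`. -/
theorem ae_uniformlyContinuous_of_memLp {T Ω : Type*} [MeasurableSpace Ω] {P : Measure Ω}
    [IsProbabilityMeasure P] {G : Ω → LInf T} (hG : StronglyMeasurable G)
    (h2 : ∀ t, MemLp (fun ω => G ω t) 2 P) :
    ∀ᵐ ω ∂P, ∀ ε > 0, ∃ δ > 0, ∀ p q, ∫ ω', (G ω' p - G ω' q) ^ 2 ∂P ≤ δ →
      |G ω p - G ω q| ≤ ε := by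
  refine ae_mem_of_isClosed_of_setAverage_mem hG
    (isClosed_setOf_uniformlyContinuous fun p q => ∫ ω', (G ω' p - G ω' q) ^ 2 ∂P)
    fun A hA h0 hi ε hε => ?_
  have hA0 : 0 < P.real A := ENNReal.toReal_pos h0 (measure_ne_top _ _)
  set η := ε * P.real A with hη
  have hη0 : 0 < η := by positivity
  refine ⟨η ^ 2, by positivity, fun p q hpq => ?_⟩
  have heval : ∀ t, (⨍ ω in A, G ω ∂P) t = (P.real A)⁻¹ * ∫ ω in A, G ω t ∂P := by
    intro t
    rw [setAverage_eq]
    have : ∫ ω in A, G ω t ∂P = (∫ ω in A, G ω ∂P) t :=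
      (lp.evalCLM ℝ (fun _ : T => ℝ) ∞ t).integral_comp_comm hi
    rw [this]
    rfl
  have hit : ∀ t, Integrable (fun ω => G ω t) P := fun t => (h2 t).integrable (by norm_num)
  have hsq : Integrable (fun ω => (G ω p - G ω q) ^ 2) P := ((h2 p).sub (h2 q)).integrable_sq
  have hd : Integrable (fun ω => G ω p - G ω q) P := (hit p).sub (hit q)
  -- `2 |u| ≤ η + u ^ 2 / η`
  have hCS : ∫ ω, |G ω p - G ω q| ∂P ≤ η := by
    have h1 : ∫ ω, |G ω p - G ω q| ∂P ≤ ∫ ω, (η / 2 + (G ω p - G ω q) ^ 2 * (2 * η)⁻¹) ∂P := by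
      refine integral_mono hd.abs ((integrable_const _).add (hsq.mul_const _)) fun ω => ?_
      have : |G ω p - G ω q| ≤ η / 2 + (G ω p - G ω q) ^ 2 / (2 * η) := by
        rw [div_add_div _ _ (by norm_num) (by positivity), le_div_iff₀ (by positivity),
          ← sq_abs (G ω p - G ω q)]
        nlinarith [sq_nonneg (|G ω p - G ω q| - η)]
      simpa [div_eq_mul_inv] using this
    rw [integral_add (integrable_const _) (hsq.mul_const _), integral_mul_const] at h1
    simp only [integral_const, probReal_univ, smul_eq_mul, one_mul] at h1
    have h3 : (∫ ω, (G ω p - G ω q) ^ 2 ∂P) * (2 * η)⁻¹ ≤ η / 2 := by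
      rw [← div_eq_mul_inv, div_le_iff₀ (by positivity)]
      nlinarith
    linarith
  rw [heval, heval, ← mul_sub, ← integral_sub (hit p).integrableOn (hit q).integrableOn,
    abs_mul, abs_of_pos (inv_pos.2 hA0), inv_mul_le_iff₀ hA0, mul_comm, ← hη]
  calc |∫ ω in A, (G ω p - G ω q) ∂P| ≤ ∫ ω in A, |G ω p - G ω q| ∂P :=
        abs_integral_le_integral_abs
    _ ≤ ∫ ω, |G ω p - G ω q| ∂P :=
        setIntegral_le_integral hd.abs (Eventually.of_forall fun ω => abs_nonneg _)
    _ ≤ η := hCS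

section Covariance

variable {E Ω₀ : Type*} [MeasurableSpace Ω₀] {P : Measure Ω₀}
  {X : Ω₀ → E → ℝ}

theorem monotone_distF [IsFiniteMeasure P] (t : E) : Monotone (distF P X t) := fun _ _ h =>
  measureReal_mono fun _ hω => le_trans hω h

theorem integral_indicator_sub_distF_mul [IsProbabilityMeasure P] {t : E}
    (hX : AEMeasurable (fun ω => X ω t) P)
    (x y : ℝ) :
    ∫ ω, ((Set.Iic x).indicator (fun _ => (1 : ℝ)) (X ω t) - distF P X t x) *
      ((Set.Iic y).indicator (fun _ => (1 : ℝ)) (X ω t) - distF P X t y) ∂P =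
    distF P X t (min x y) - distF P X t x * distF P X t y := by
  have hI : ∀ z : ℝ, (∫ ω, (Set.Iic z).indicator (fun _ => (1 : ℝ)) (X ω t) ∂P = distF P X t z) ∧
      Integrable (fun ω => (Set.Iic z).indicator (fun _ => (1 : ℝ)) (X ω t)) P := by
    intro z
    have hm : NullMeasurableSet {ω | X ω t ≤ z} P := hX.nullMeasurableSet_preimage measurableSet_Iic
    have he : (fun ω => (Set.Iic z).indicator (fun _ => (1 : ℝ)) (X ω t)) =
        {ω | X ω t ≤ z}.indicator fun _ => (1 : ℝ) := by
      funext ω; simp [Set.indicator]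
    rw [he, integral_indicator₀ hm]
    exact ⟨by simp [distF, Measure.real], (integrable_const _).indicator₀ hm⟩
  have hexp : ∀ ω, ((Set.Iic x).indicator (fun _ => (1 : ℝ)) (X ω t) - distF P X t x) *
      ((Set.Iic y).indicator (fun _ => (1 : ℝ)) (X ω t) - distF P X t y) =
      ((Set.Iic (min x y)).indicator (fun _ => (1 : ℝ)) (X ω t)
        - (Set.Iic x).indicator (fun _ => (1 : ℝ)) (X ω t) * distF P X t y)
        - ((Set.Iic y).indicator (fun _ => (1 : ℝ)) (X ω t) * distF P X t x
        - distF P X t x * distF P X t y) := by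
    intro ω
    have : (Set.Iic (min x y)).indicator (fun _ => (1 : ℝ)) (X ω t) =
        (Set.Iic x).indicator (fun _ => (1 : ℝ)) (X ω t) *
          (Set.Iic y).indicator (fun _ => (1 : ℝ)) (X ω t) := by
      by_cases h1 : X ω t ≤ x <;> by_cases h2 : X ω t ≤ y <;> simp [Set.indicator, h1, h2]
    rw [this]; ring
  simp only [hexp]
  have i1 := (hI x).2.mul_const (distF P X t y)
  have i2 := (hI y).2.mul_const (distF P X t x)
  have i3 : Integrable (fun ω => (Set.Iic (min x y)).indicator (fun _ => (1 : ℝ)) (X ω t) -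
      (Set.Iic x).indicator (fun _ => (1 : ℝ)) (X ω t) * distF P X t y) P := (hI _).2.sub i1
  have i4 : Integrable (fun ω => (Set.Iic y).indicator (fun _ => (1 : ℝ)) (X ω t) *
      distF P X t x - distF P X t x * distF P X t y) P := i2.sub (integrable_const _)
  rw [integral_sub i3 i4, integral_sub (hI (min x y)).2 i1, integral_sub i2 (integrable_const _),
    integral_mul_const,
    integral_mul_const, (hI x).1, (hI y).1, (hI _).1]
  simp only [integral_const, probReal_univ, smul_eq_mul, one_mul]
  ring

variable {Ω : Type*} [MeasurableSpace Ω] {Q : Measure Ω}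
  {Xs : ℕ → Ω → E → ℝ} {G : Ω → E × ℝ → ℝ}

theorem EmpiricalCLT.memLp (h : EmpiricalCLT P X Q Xs G) (p : E × ℝ) :
    MemLp (fun ω => G ω p) 2 Q :=
  (h.clt.gaussian.hasGaussianLaw_eval p).memLp_two

/-- The squared `L²` distance of `G (t, x)` and `G (t, y)` is `d - d ^ 2` with
`d = |F (t, x) - F (t, y)|`. -/
theorem EmpiricalCLT.integral_sub_sq_le [IsProbabilityMeasure P]
    (h : EmpiricalCLT P X Q Xs G) {t : E}
    (hX : AEMeasurable (fun ω => X ω t) P) (x y : ℝ) :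
    ∫ ω, (G ω (t, x) - G ω (t, y)) ^ 2 ∂Q ≤ |distF P X t x - distF P X t y| := by
  have hxx := (h.covariance t t x x).trans (integral_indicator_sub_distF_mul hX x x)
  have hxy := (h.covariance t t x y).trans (integral_indicator_sub_distF_mul hX x y)
  have hyy := (h.covariance t t y y).trans (integral_indicator_sub_distF_mul hX y y)
  rw [min_self] at hxx hyy
  have hi : ∀ p q, Integrable (fun ω => G ω p * G ω q) Q := fun p q =>
    (h.memLp p).integrable_mul (h.memLp q)
  have hexp : ∀ ω, (G ω (t, x) - G ω (t, y)) ^ 2 = G ω (t, x) * G ω (t, x) -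
      2 * (G ω (t, x) * G ω (t, y)) + G ω (t, y) * G ω (t, y) := fun ω => by ring
  simp only [hexp]
  have i1 : Integrable (fun ω => G ω (t, x) * G ω (t, x) - 2 * (G ω (t, x) * G ω (t, y))) Q :=
    (hi _ _).sub ((hi _ _).const_mul 2)
  rw [integral_add i1 (hi _ _),
    integral_sub (hi _ _) ((hi _ _).const_mul 2), integral_const_mul, hxx, hxy, hyy]
  rcases le_total x y with hle | hle
  · have := monotone_distF (P := P) (X := X) t hle
    rw [min_eq_left hle, abs_of_nonpos (by linarith)]
    nlinarith [sq_nonneg (distF P X t x - distF P X t y)]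
  · have := monotone_distF (P := P) (X := X) t hle
    rw [min_eq_right hle, abs_of_nonneg (by linarith)]
    nlinarith [sq_nonneg (distF P X t x - distF P X t y)]

/-- Almost all paths of the limit process are uniformly continuous on the scale of `F`. -/
theorem EmpiricalCLT.ae_uniformlyContinuous [IsProbabilityMeasure P]
    [IsProbabilityMeasure Q] (h : EmpiricalCLT P X Q Xs G)
    (hX : ∀ t, AEMeasurable (fun ω => X ω t) P) :
    ∀ᵐ ω ∂Q, ∀ ε > 0, ∃ δ > 0, ∀ t x y, |distF P X t x - distF P X t y| ≤ δ →
      |G ω (t, x) - G ω (t, y)| ≤ ε := by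
  obtain ⟨Z', hZ', hZ⟩ := h.clt.radon
  have := ae_uniformlyContinuous_of_memLp (P := Q) hZ' (fun p => by
    simpa only [hZ] using h.memLp p)
  simp only [hZ] at this
  filter_upwards [this] with ω hω ε hε
  obtain ⟨δ, hδ, hδ'⟩ := hω ε hε
  exact ⟨δ, hδ, fun t x y hxy => hδ' _ _ ((h.integral_sub_sq_le (hX t) x y).trans hxy)⟩

end Covariance

/-! ### Symmetry of the law of the limit process -/

theorem map_neg_eq_of_isGaussian {V : Type*} [NormedAddCommGroup V] [NormedSpace ℝ V]
    [CompleteSpace V] [MeasurableSpace V] [BorelSpace V] [SecondCountableTopology V]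
    {μ : Measure V} [IsGaussian μ] (h0 : ∀ L : StrongDual ℝ V, ∫ x, L x ∂μ = 0) :
    μ.map (fun x => -x) = μ := by
  have hmap : μ.map (fun x => -x) = μ.map (-ContinuousLinearMap.id ℝ V) := rfl
  have : IsFiniteMeasure (μ.map (-ContinuousLinearMap.id ℝ V)) := inferInstance
  rw [hmap]
  refine Measure.ext_of_charFunDual (funext fun L => ?_)
  have hL : L ∘L (-ContinuousLinearMap.id ℝ V) = -L := by ext x; simp
  rw [charFunDual_map, hL, IsGaussian.charFunDual_eq, IsGaussian.charFunDual_eq]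
  have hv : Var[⇑(-L); μ] = Var[⇑L; μ] := by
    rw [show ⇑(-L) = -⇑L from rfl, variance_neg]
  have h1 := h0 L
  have h2 := h0 (-L)
  simp only [integral_complex_ofReal, h1, h2, hv]

/-- The finite-dimensional laws of a centered Gaussian process are symmetric. -/
theorem map_restrict_neg_eq {T Ω : Type*} [MeasurableSpace Ω] {P : Measure Ω}
    {Z : T → Ω → ℝ} (hG : IsGaussianProcess Z P) (h0 : ∀ t, ∫ ω, Z t ω ∂P = 0) (I : Finset T) :
    P.map (fun ω => I.restrict fun t => -Z t ω) = P.map (fun ω => I.restrict fun t => Z t ω) := by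
  have hI := hG.hasGaussianLaw I
  have hgm := hI.isGaussian_map
  have hi : Integrable (fun ω => I.restrict fun t => Z t ω) P :=
    hI.integrable
  have hneg : P.map (fun ω => I.restrict fun t => -Z t ω) =
      (P.map fun ω => I.restrict fun t => Z t ω).map (fun x => -x) := by
    rw [AEMeasurable.map_map_of_aemeasurable measurable_neg.aemeasurable hi.aemeasurable]
    rfl
  rw [hneg]
  refine map_neg_eq_of_isGaussian fun L => ?_
  rw [integral_map hi.aemeasurable L.continuous.aestronglyMeasurable, L.integral_comp_comm hi]
  have : ∫ ω, (I.restrict fun t => Z t ω) ∂P = 0 := by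
    funext i
    have := (ContinuousLinearMap.proj (R := ℝ) (φ := fun _ : I => ℝ) i).integral_comp_comm hi
    simp only [ContinuousLinearMap.proj_apply] at this
    rw [← this]
    exact h0 i
  rw [this, map_zero]

/-- On a separable subset of `ℓ_∞(T)` that is closed under subtraction, countably many coordinates
separate points. -/
theorem exists_seq_injOn {T : Type*} [Nonempty T] {W : Set (LInf T)}
    (hW : TopologicalSpace.IsSeparable W) (hsub : ∀ z ∈ W, ∀ w ∈ W, z - w ∈ W) :
    ∃ e : ℕ → T, Set.InjOn (fun (z : LInf T) (i : ℕ) => z (e i)) W := by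
  obtain ⟨c, hc, hcl⟩ := hW
  rcases c.eq_empty_or_nonempty with rfl | hne
  · rw [closure_empty, Set.subset_empty_iff] at hcl
    exact ⟨fun _ => Classical.arbitrary T, by simp [hcl]⟩
  obtain ⟨y, rfl⟩ := hc.exists_eq_range hne
  have he : ∀ i, ∃ t, ‖y i‖ / 2 ≤ |y i t| := by
    intro i
    rcases eq_or_ne (y i) 0 with h0 | h0
    · exact ⟨Classical.arbitrary T, by simp [h0]⟩
    by_contra! hlt
    have : ‖y i‖ ≤ ‖y i‖ / 2 := lp.norm_le_of_forall_le (by positivity) fun t => (hlt t).le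
    linarith [norm_pos_iff.2 h0]
  choose e he using he
  refine ⟨e, fun z hz w hw hzw => sub_eq_zero.1 ?_⟩
  rw [← norm_le_zero_iff]
  refine le_of_forall_pos_le_add fun δ hδ => ?_
  obtain ⟨_, ⟨i, rfl⟩, hi⟩ := Metric.mem_closure_iff.1 (hcl (hsub z hz w hw)) (δ / 3)
    (by positivity)
  rw [dist_eq_norm] at hi
  have h1 : (z - w) (e i) = 0 := by
    have : z (e i) = w (e i) := congrFun hzw i
    rw [lp.coeFn_sub, Pi.sub_apply, this, sub_self]
  have h2 := abs_coe_sub_coe_le (z - w) (y i) (e i)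
  rw [h1, zero_sub, abs_neg] at h2
  have h3 := norm_le_norm_add_norm_sub' (z - w) (y i)
  linarith [he i]

/-- A centered Gaussian process with a Radon law in `ℓ_∞(T)` has a symmetric law: on a separable
closed subspace finitely many coordinates at a time determine a Borel measure. -/
theorem integral_comp_neg_eq {T Ω : Type*} [MeasurableSpace Ω] {P : Measure Ω}
    [IsProbabilityMeasure P] {Z : Ω → LInf T} (hZ : StronglyMeasurable Z)
    (hG : IsGaussianProcess (fun t ω => Z ω t) P) (h0 : ∀ t, ∫ ω, Z ω t ∂P = 0)
    {H : LInf T → ℝ} (hH : Continuous H) :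
    ∫ ω, H (-Z ω) ∂P = ∫ ω, H (Z ω) ∂P := by
  rcases isEmpty_or_nonempty T with hT | hT
  · have : ∀ ω, -Z ω = Z ω := fun ω => by ext t; exact hT.elim t
    simp only [this]
  set W : Submodule ℝ (LInf T) := (Submodule.span ℝ (Set.range Z)).topologicalClosure with hWdef
  have hWs : TopologicalSpace.IsSeparable (W : Set (LInf T)) := by
    rw [hWdef, Submodule.topologicalClosure_coe]
    exact (hZ.isSeparable_range.span (R := ℝ)).closure
  have hWc : IsClosed (W : Set (LInf T)) := Submodule.isClosed_topologicalClosure _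
  have hmem : ∀ ω, Z ω ∈ W := fun ω =>
    Submodule.le_topologicalClosure _ (Submodule.subset_span ⟨ω, rfl⟩)
  have hsep : TopologicalSpace.SeparableSpace W := hWs.separableSpace
  have hcomp : CompleteSpace W := hWc.completeSpace_coe
  have hsc : SecondCountableTopology W := UniformSpace.secondCountable_of_separable W
  have hpol : PolishSpace W := inferInstance
  borelize (LInf T)
  have hbor : BorelSpace W := Subtype.borelSpace _
  -- by the Lusin-Souslin theorem the coordinates embed `W` measurably into `ℕ → ℝ`
  obtain ⟨e, he⟩ := exists_seq_injOn hWs fun z hz w hw => W.sub_mem hz hw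
  set R : W → ℕ → ℝ := fun z i => (z : LInf T) (e i) with hR
  have hRc : Continuous R := continuous_pi fun i =>
    (lp.evalCLM ℝ (fun _ : T => ℝ) ∞ (e i)).continuous.comp continuous_subtype_val
  have hRi : Function.Injective R := fun z w hzw => Subtype.ext (he z.2 w.2 hzw)
  have hRe : MeasurableEmbedding R := hRc.measurableEmbedding hRi
  set ZW : Ω → W := fun ω => ⟨Z ω, hmem ω⟩ with hZW
  have hZWm : Measurable ZW := hZ.measurable.subtype_mk
  have hZWn : Measurable fun ω => -ZW ω := hZWm.neg
  have hlaw : P.map (fun ω => -ZW ω) = P.map ZW := by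
    have h1 : (P.map (fun ω => -ZW ω)).map R = (P.map ZW).map R := by
      rw [Measure.map_map hRc.measurable hZWn, Measure.map_map hRc.measurable hZWm]
      have hm1 : AEMeasurable (fun ω (i : ℕ) => -Z ω (e i)) P :=
        (hRc.measurable.comp hZWn).aemeasurable
      have hm2 : AEMeasurable (fun ω (i : ℕ) => Z ω (e i)) P :=
        (hRc.measurable.comp hZWm).aemeasurable
      exact (map_eq_iff_forall_finset_map_restrict_eq (X := fun i ω => -Z ω (e i))
        (Y := fun i ω => Z ω (e i)) hm1 hm2).2
        fun I => map_restrict_neg_eq (hG.comp_right e) (fun i => h0 (e i)) I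
    rw [← hRe.comap_map (P.map fun ω => -ZW ω), h1, hRe.comap_map]
  have hHc : Continuous fun z : W => H z := hH.comp continuous_subtype_val
  have e1 := integral_map (μ := P) hZWn.aemeasurable
    (hHc.aestronglyMeasurable (μ := P.map fun ω => -ZW ω))
  have e2 := integral_map (μ := P) hZWm.aemeasurable
    (hHc.aestronglyMeasurable (μ := P.map ZW))
  rw [hlaw, e2] at e1
  exact e1.symm

/-! ### Distribution functions and quantiles -/

section Dist

variable {E Ω₀ : Type*} [MeasurableSpace Ω₀] {P : Measure Ω₀} [IsProbabilityMeasure P]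
  {X : Ω₀ → E → ℝ} {f : E → ℝ → ℝ}

theorem distF_eq_cdf {t : E} (hX : AEMeasurable (fun ω => X ω t) P) (x : ℝ) :
    distF P X t x = cdf (P.map fun ω => X ω t) x := by
  have := Measure.isProbabilityMeasure_map hX
  rw [cdf_eq_real, distF, map_measureReal_apply_of_aemeasurable hX measurableSet_Iic]
  rfl

/-- The distribution function has the continuous density as its derivative. -/
theorem HasDensities.hasDerivAt_distF (h : HasDensities P X f) {t : E}
    (hX : AEMeasurable (fun ω => X ω t) P) (hc : Continuous (f t)) (x : ℝ) :
    HasDerivAt (distF P X t) (f t x) x := by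
  have hprob := Measure.isProbabilityMeasure_map hX
  have hinc : ∀ a b, a ≤ b → distF P X t b - distF P X t a = ∫ y in a..b, f t y := by
    intro a b hab
    have h1 : distF P X t b - distF P X t a = (P.map fun ω => X ω t).real (Set.Ioc a b) := by
      rw [distF_eq_cdf hX, distF_eq_cdf hX, cdf_eq_real, cdf_eq_real, ← Set.Iic_sdiff_Iic,
        measureReal_sdiff (Set.Iic_subset_Iic.2 hab) measurableSet_Iic]
    rw [h1, intervalIntegral.integral_of_le hab, Measure.real, h.density t,
      withDensity_apply _ measurableSet_Ioc,
      integral_eq_lintegral_of_nonneg_ae (Eventually.of_forall fun y => h.nonneg t y)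
        hc.aestronglyMeasurable]
  have hinc' : ∀ y, distF P X t y = distF P X t x + ∫ z in x..y, f t z := by
    intro y
    rcases le_total x y with hxy | hxy
    · linarith [hinc x y hxy]
    · rw [intervalIntegral.integral_symm]
      linarith [hinc y x hxy]
  have hd := intervalIntegral.integral_hasDerivAt_right (hc.intervalIntegrable x x)
    hc.stronglyMeasurable.stronglyMeasurableAtFilter hc.continuousAt
  exact (hd.const_add (distF P X t x)).congr_of_eventuallyEq (Eventually.of_forall hinc')

theorem distF_leftInv {t : E} (hX : AEMeasurable (fun ω => X ω t) P)
    (hc : Continuous (distF P X t)) (hm : StrictMono (distF P X t)) {α : ℝ} (h0 : 0 < α)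
    (h1 : α < 1) : distF P X t (leftInv (distF P X t) α) = α := by
  have hbot : Tendsto (distF P X t) atBot (𝓝 0) := by
    rw [show distF P X t = _ from funext (distF_eq_cdf hX)]; exact tendsto_cdf_atBot _
  have htop : Tendsto (distF P X t) atTop (𝓝 1) := by
    rw [show distF P X t = _ from funext (distF_eq_cdf hX)]; exact tendsto_cdf_atTop _
  obtain ⟨a, ha⟩ := (hbot.eventually_lt_const h0).exists
  obtain ⟨b, hb⟩ := (htop.eventually_const_lt h1).exists
  obtain ⟨x, hx⟩ := mem_range_of_exists_le_of_exists_ge hc ⟨a, ha.le⟩ ⟨b, hb.le⟩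
  have hset : {y | α ≤ distF P X t y} = Set.Ici x := by
    ext y
    rw [Set.mem_ofPred_eq, ← hx, hm.le_iff_le]
    rfl
  rw [leftInv, hset, csInf_Ici, hx]

end Dist

section Emp

variable {E Ω : Type*} {X : ℕ → Ω → E → ℝ} {n : ℕ} {ω : Ω} {t : E}

theorem monotone_empF : Monotone (empF X n ω t) := fun x y hxy => by
  refine mul_le_mul_of_nonneg_left (Finset.sum_le_sum fun i _ => ?_) (by positivity)
  exact Set.indicator_le_indicator_of_subset (Set.Iic_subset_Iic.2 hxy) (fun _ => zero_le_one) _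

theorem exists_empF_eq_zero : ∃ x, ∀ y ≤ x, empF X n ω t y = 0 := by
  obtain ⟨m, hm⟩ := (Finset.image (fun i => X i ω t) (Finset.range n)).bddBelow
  refine ⟨m - 1, fun y hy => ?_⟩
  rw [empF, Finset.sum_eq_zero fun i hi => Set.indicator_of_notMem (fun h => ?_) _, mul_zero]
  have h1 : m ≤ X i ω t := hm (by simpa using ⟨i, Finset.mem_range.1 hi, rfl⟩)
  have h2 : X i ω t ≤ y := h
  linarith

theorem exists_empF_eq_one (hn : n ≠ 0) : ∃ x, empF X n ω t x = 1 := by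
  obtain ⟨m, hm⟩ := (Finset.image (fun i => X i ω t) (Finset.range n)).bddAbove
  refine ⟨m, ?_⟩
  have : ∀ i ∈ Finset.range n, (Set.Iic m).indicator (fun _ => (1 : ℝ)) (X i ω t) = 1 :=
    fun i hi => Set.indicator_of_mem (s := Set.Iic m)
      (hm (by simpa using ⟨i, Finset.mem_range.1 hi, rfl⟩)) _
  rw [empF, Finset.sum_congr rfl this]
  simp [hn]

theorem empF_lt_of_lt_leftInv {α x : ℝ} (h0 : 0 < α) (hx : x < leftInv (empF X n ω t) α) :
    empF X n ω t x < α := by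
  obtain ⟨m, hm⟩ := exists_empF_eq_zero (X := X) (n := n) (ω := ω) (t := t)
  by_contra hle
  refine notMem_of_lt_csInf hx ⟨m, fun y hy => ?_⟩ (not_lt.1 hle)
  by_contra hlt
  have : α ≤ empF X n ω t y := hy
  rw [hm y (not_le.1 hlt).le] at this
  linarith

theorem le_empF_of_leftInv_lt {α x : ℝ} (hn : n ≠ 0) (h1 : α ≤ 1)
    (hx : leftInv (empF X n ω t) α < x) : α ≤ empF X n ω t x := by
  obtain ⟨m, hm⟩ := exists_empF_eq_one (X := X) (ω := ω) (t := t) hn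
  obtain ⟨y, hy, hyx⟩ := exists_lt_of_csInf_lt ⟨m, show α ≤ empF X n ω t m by rwa [hm]⟩ hx
  exact le_trans hy (monotone_empF hyx.le)

end Emp

/-- The pathwise expansion of a quantile: `z` is a path close to the empirical process `r (Fn - F)`
and continuous on the scale of `F`, and `τh` is the `α`-quantile of `Fn`. -/
theorem abs_quantile_add_le {F Fn f z : ℝ → ℝ} {α τ τh r K ε η δ c d κ : ℝ}
    (hF : ∀ x, HasDerivAt F (f x) x) (hmono : StrictMono F) (hτ : F τ = α)
    (hlt : ∀ x < τh, Fn x < α) (hgt : ∀ x, τh < x → α ≤ Fn x) (hr : 0 < r)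
    (hν : ∀ x, |r * (Fn x - F x) - z x| ≤ η) (hz : ∀ x, |z x| ≤ K) (hδ : 0 < δ)
    (hzδ : ∀ x y, |F x - F y| ≤ δ → |z x - z y| ≤ ε) (hrδ : K + ε + η ≤ r * δ)
    (hd : 0 < d) (hrd : K + ε + η = r * c * d) (hfc : ∀ x, |x - τ| ≤ d → c ≤ f x)
    (hfκ : ∀ x, |x - τ| ≤ d → |f x - f τ| ≤ κ) :
    |r * (τh - τ) * f τ + z τ| ≤ 2 * ε + η + r * d * κ := by
  have hFc : Continuous F := continuous_iff_continuousAt.2 fun x => (hF x).continuousAt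
  have hnear : ∀ᶠ x in 𝓝 τh, |F x - F τh| ≤ δ := by
    have := (hFc.tendsto τh).eventually (Metric.closedBall_mem_nhds (F τh) hδ)
    simpa [Metric.mem_closedBall, Real.dist_eq] using this
  have hlim : Tendsto (fun x => r * (F x - α)) (𝓝 τh) (𝓝 (r * (F τh - α))) :=
    ((hFc.tendsto τh).sub_const α).const_mul r
  -- the value of `F` at the empirical quantile, from both sides
  have hup : r * (F τh - α) ≤ -z τh + ε + η := by
    refine le_of_tendsto (hlim.mono_left (nhdsWithin_le_nhds (s := Set.Iio τh))) ?_
    filter_upwards [nhdsWithin_le_nhds hnear, self_mem_nhdsWithin] with x hx hxτ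
    have h1 := (abs_le.1 (hν x)).1
    have h2 := (abs_le.1 (hzδ _ _ hx)).1
    have h3 := mul_lt_mul_of_pos_left (hlt x hxτ) hr
    nlinarith
  have hlo : -z τh - ε - η ≤ r * (F τh - α) := by
    refine ge_of_tendsto (hlim.mono_left (nhdsWithin_le_nhds (s := Set.Ioi τh))) ?_
    filter_upwards [nhdsWithin_le_nhds hnear, self_mem_nhdsWithin] with x hx hxτ
    have h1 := (abs_le.1 (hν x)).2
    have h2 := (abs_le.1 (hzδ _ _ hx)).2
    have h3 := mul_le_mul_of_nonneg_left (hgt x hxτ) hr.le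
    nlinarith
  have hzτ := abs_le.1 (hz τh)
  -- `z` may now be taken at `τ` in place of `τh`
  have hFα : |F τh - F τ| ≤ δ := by
    rw [hτ, abs_le]
    constructor
    · by_contra h
      have := mul_lt_mul_of_pos_left (not_le.1 h) hr
      linarith
    · by_contra h
      have := mul_lt_mul_of_pos_left (not_le.1 h) hr
      linarith
  have hzz := abs_le.1 (hzδ _ _ hFα)
  -- mean value theorem with the base point `τ`
  have hmvt : ∀ x, ∃ ξ, |ξ - τ| ≤ |x - τ| ∧ F x - F τ = f ξ * (x - τ) := by
    intro x
    rcases lt_trichotomy x τ with h | rfl | h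
    · obtain ⟨ξ, hξ, he⟩ := exists_hasDerivAt_eq_slope F f h hFc.continuousOn fun y _ => hF y
      refine ⟨ξ, ?_, ?_⟩
      · rw [abs_of_nonpos (by linarith [hξ.2]), abs_of_nonpos (by linarith)]
        linarith [hξ.1]
      · rw [eq_div_iff (by linarith)] at he
        linarith
    · exact ⟨x, le_rfl, by simp⟩
    · obtain ⟨ξ, hξ, he⟩ := exists_hasDerivAt_eq_slope F f h hFc.continuousOn fun y _ => hF y
      refine ⟨ξ, ?_, ?_⟩
      · rw [abs_of_nonneg (by linarith [hξ.1]), abs_of_nonneg (by linarith)]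
        linarith [hξ.2]
      · rw [eq_div_iff (by linarith)] at he
        linarith
  -- since `F` grows by at least `c * d` on either side of `τ`, the quantiles are `d`-close
  have hclose : |τh - τ| ≤ d := by
    rw [abs_le]
    constructor
    · by_contra h
      obtain ⟨ξ, hξ, he⟩ := hmvt (τ - d)
      rw [show τ - d - τ = -d by ring, abs_neg, abs_of_pos hd] at hξ
      rw [show τ - d - τ = -d by ring] at he
      have h1 := hmono (show τh < τ - d by linarith [not_le.1 h])
      have h2 := mul_lt_mul_of_pos_left h1 hr
      have h3 := mul_le_mul_of_nonneg_left (mul_le_mul_of_nonneg_right (hfc ξ hξ) hd.le) hr.le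
      nlinarith
    · by_contra h
      obtain ⟨ξ, hξ, he⟩ := hmvt (τ + d)
      rw [show τ + d - τ = d by ring, abs_of_pos hd] at hξ
      rw [show τ + d - τ = d by ring] at he
      have h1 := hmono (show τ + d < τh by linarith [not_le.1 h])
      have h2 := mul_lt_mul_of_pos_left h1 hr
      have h3 := mul_le_mul_of_nonneg_left (mul_le_mul_of_nonneg_right (hfc ξ hξ) hd.le) hr.le
      nlinarith
  obtain ⟨ξ, hξ, he⟩ := hmvt τh
  have hκ := hfκ ξ (hξ.trans hclose)
  have herr : |r * (τh - τ) * f τ - r * (F τh - α)| ≤ r * d * κ := by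
    rw [← hτ, he, show r * (τh - τ) * f τ - r * (f ξ * (τh - τ)) = -(r * (τh - τ) * (f ξ - f τ)) by
      ring, abs_neg, abs_mul, abs_mul, abs_of_pos hr]
    exact mul_le_mul (mul_le_mul_of_nonneg_left hclose hr.le) hκ (abs_nonneg _) (by positivity)
  have h4 := abs_le.1 herr
  exact abs_le.2 ⟨by linarith [hzz.1, hzz.2], by linarith [hzz.1, hzz.2]⟩

/-! ### Transfer to weighted coordinates -/

theorem isGaussianProcess_comp_measurePreserving {T Ω Ω' : Type*} [MeasurableSpace Ω]
    [MeasurableSpace Ω'] {P : Measure Ω'} {Q : Measure Ω} {Z : T → Ω → ℝ}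
    (h : IsGaussianProcess Z Q) {g : Ω' → Ω} (hg : MeasurePreserving g P Q) :
    IsGaussianProcess (fun t ω => Z t (g ω)) P := by
  refine ⟨fun I => ⟨?_⟩⟩
  have hm : AEMeasurable (fun ω => I.restrict (Z · ω)) (P.map g) := by
    rw [hg.map_eq]; exact (h.hasGaussianLaw I).aemeasurable
  have := (h.hasGaussianLaw I).isGaussian_map
  rwa [← hg.map_eq, AEMeasurable.map_map_of_aemeasurable hm hg.aemeasurable] at this

/-- A restriction to some coordinates with bounded weights is a continuous map of `ℓ_∞` spaces. -/
theorem exists_continuous_weighted {S T : Type*} (ι : S → T) {m : S → ℝ} {C : ℝ}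
    (hm : ∀ s, |m s| ≤ C) :
    ∃ Φ : LInf T → LInf S, Continuous Φ ∧ ∀ z s, Φ z s = m s * z (ι s) := by
  have hb : ∀ (z : LInf T) s, |m s * z (ι s)| ≤ |C| * ‖z‖ := fun z s => by
    rw [abs_mul]
    exact mul_le_mul ((hm s).trans (le_abs_self C))
      (lp.norm_apply_le_norm ENNReal.top_ne_zero z (ι s)) (abs_nonneg _) (abs_nonneg _)
  refine ⟨fun z => ⟨fun s => m s * z (ι s), memℓp_infty ⟨|C| * ‖z‖, ?_⟩⟩, ?_, fun z s => rfl⟩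
  · rintro _ ⟨s, rfl⟩
    exact hb z s
  · refine (LipschitzWith.of_dist_le_mul (K := Real.nnabs C) fun z w => ?_).continuous
    rw [dist_eq_norm, dist_eq_norm, Real.coe_nnabs]
    refine lp.norm_le_of_forall_le (by positivity) fun s => ?_
    have := hb (z - w) s
    rw [lp.coeFn_sub, Pi.sub_apply, mul_sub] at this
    exact this

/-- Convergence to zero in outer probability survives multiplication by bounded weights. -/
theorem tendsto_measure_cover_mul {S Ω : Type*} [MeasurableSpace Ω] {P : Measure Ω}
    [IsFiniteMeasure P] {U : ℕ → Ω → S → ℝ}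
    (h : ∀ ε : ℝ, 0 < ε → Tendsto (fun n => P {ω | ENNReal.ofReal ε <
      cover P (fun ω' => supNorm (U n ω')) ω}) atTop (𝓝 0))
    {m : S → ℝ} {C : ℝ} (hC : 0 < C) (hm : ∀ s, |m s| ≤ C) {ε : ℝ} (hε : 0 < ε) :
    Tendsto (fun n => P {ω | ENNReal.ofReal ε <
      cover P (fun ω' => supNorm fun s => m s * U n ω' s) ω}) atTop (𝓝 0) := by
  refine tendsto_of_tendsto_of_tendsto_of_le_of_le tendsto_const_nhds (h (ε / C) (by positivity))
    (fun _ => zero_le) fun n => measure_mono_ae ?_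
  have hle : cover P (fun ω' => supNorm fun s => m s * U n ω' s) ≤ᵐ[P]
      fun ω => ENNReal.ofReal C * cover P (fun ω' => supNorm (U n ω')) ω := by
    refine cover_le_ae _ _ _ ((measurable_cover _ _).const_mul _)
      (Eventually.of_forall fun ω => iSup_le fun s => ?_)
    rw [enorm_mul]
    refine mul_le_mul' ?_ ((le_iSup (fun s => ‖U n ω s‖ₑ) s).trans (le_cover P _ ω))
    rw [← ofReal_norm]
    exact ENNReal.ofReal_le_ofReal (hm s)
  filter_upwards [hle] with ω hω hlt
  have h1 : ENNReal.ofReal ε < _ := lt_of_lt_of_le hlt hω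
  change ENNReal.ofReal (ε / C) < _
  rw [ENNReal.ofReal_div_of_pos hC]
  exact ENNReal.div_lt_of_lt_mul' h1

/-- If `Y n` approaches `-Z` in outer probability, `Z` a weighted restriction of a centered Gaussian
process with a Radon law, then `Y n` satisfies the central limit theorem with limit `Z`, since
`Z` has a symmetric law. -/
theorem satisfiesCLT_of_tendsto_cover_add {S T Ω : Type*} [MeasurableSpace Ω] {P : Measure Ω}
    [IsProbabilityMeasure P] {Y : ℕ → Ω → S → ℝ} {W : Ω → LInf T} (hW : StronglyMeasurable W)
    (hG : IsGaussianProcess (fun t ω => W ω t) P) (h0 : ∀ t, ∫ ω, W ω t ∂P = 0)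
    (ι : S → T) {m : S → ℝ} {C : ℝ} (hm : ∀ s, |m s| ≤ C)
    (h : ∀ ε : ℝ, 0 < ε → Tendsto (fun n => P {ω | ENNReal.ofReal ε <
      cover P (fun ω' => supNorm fun s => Y n ω' s + m s * W ω' (ι s)) ω}) atTop (𝓝 0)) :
    SatisfiesCLT P Y P (fun ω s => m s * W ω (ι s)) := by
  obtain ⟨Φ, hΦ, hΦe⟩ := exists_continuous_weighted ι hm
  have hZm : StronglyMeasurable fun ω => Φ (W ω) := hΦ.comp_stronglyMeasurable hW
  have hZG : IsGaussianProcess (fun s ω => m s * W ω (ι s)) P := (hG.comp_right ι).smul m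
  have hZ0 : ∀ s, ∫ ω, m s * W ω (ι s) ∂P = 0 := fun s => by
    rw [integral_const_mul, h0, mul_zero]
  refine ⟨⟨_, hZm, fun ω s => hΦe _ s⟩, hZG, hZ0, ?_⟩
  have hneg : ConvergesInLaw P Y P (fun ω s => -(m s * W ω (ι s))) :=
    convergesInLaw_of_tendsto_cover (Z' := fun ω => -Φ (W ω)) hZm.neg
      (fun ω s => by rw [lp.coeFn_neg, Pi.neg_apply, hΦe]) (by simpa only [sub_neg_eq_add] using h)
  intro H hHb hHc
  have hsymm := integral_comp_neg_eq (P := P) hZm (by simpa only [hΦe] using hZG)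
    (by simpa only [hΦe] using hZ0) hHc
  simp only [lp.coeFn_neg, Pi.neg_apply, hΦe] at hsymm
  rw [← hsymm]
  exact hneg H hHb hHc

/-! ### The quantile processes -/

section Quantile

variable {E Ω₀ Ω Ωh : Type*} [MeasurableSpace Ω₀] [MeasurableSpace Ω] [MeasurableSpace Ωh]
  {P : Measure Ω₀} [IsProbabilityMeasure P] {X : Ω₀ → E → ℝ}
  {Q : Measure Ω} [IsProbabilityMeasure Q] {Xs : ℕ → Ω → E → ℝ} {G : Ω → E × ℝ → ℝ}
  {f : E → ℝ → ℝ} {Ph : Measure Ωh} {g : ℕ → Ωh → Ω}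

/-- On any representation space the standardized quantile process approaches `-G` in outer
probability: outside an event of small probability the path of `G` is bounded, it is uniformly
continuous with a fixed modulus, and the empirical process is close to it. -/
theorem tendsto_measure_cover_quantile (hX : ∀ t, AEMeasurable (fun ω => X ω t) P)
    (hmono : ∀ t, StrictMono (distF P X t)) (hdens : HasDensities P X f)
    (hequi : UniformEquicontinuous f) (hbelow : BoundedBelowNearQuantiles P X f)
    (hclt : EmpiricalCLT P X Q Xs G) (hg : IsRepresentation Q (empProcess P X Xs) G Ph g)
    {a b : ℝ} (ha : 0 < a) (hab : a ≤ b) (hb : b < 1) {ε₀ : ℝ} (hε₀ : 0 < ε₀) :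
    Tendsto (fun n : ℕ => Ph {ω | ENNReal.ofReal ε₀ <
      cover Ph (fun ω' => supNorm (fun p : E × Set.Icc a b =>
        √(n : ℝ) * (leftInv (empF Xs n (g n ω') p.1) p.2 - leftInv (distF P X p.1) p.2)
          * f p.1 (leftInv (distF P X p.1) p.2)
          + G (g 0 ω') (p.1, leftInv (distF P X p.1) p.2))) ω}) atTop (𝓝 0) := by
  classical
  have := hg.prob
  have hfc : ∀ t, Continuous (f t) := fun t => (hequi.uniformContinuous t).continuous
  have hderiv : ∀ t x, HasDerivAt (distF P X t) (f t x) x := fun t x =>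
    hdens.hasDerivAt_distF (hX t) (hfc t) x
  have hFc : ∀ t, Continuous (distF P X t) := fun t =>
    continuous_iff_continuousAt.2 fun x => (hderiv t x).continuousAt
  obtain ⟨Z', hZ', hZ⟩ := hclt.clt.radon
  set W : Ωh → LInf (E × ℝ) := fun ω => Z' (g 0 ω) with hW
  have hWm : StronglyMeasurable W := hZ'.comp_measurable (hg.preserving 0).measurable
  borelize (LInf (E × ℝ))
  -- the expansion has error at most `4 * ε`
  set ε := ε₀ / 5 with hε
  have hε0 : 0 < ε := by positivity
  set D : ℕ → Ωh → ℝ≥0∞ := fun n => cover Ph (fun ω' => supNorm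
    (fun s => empProcess P X Xs n (g n ω') s - G (g 0 ω') s)) with hD
  set V : ℝ → Set (LInf (E × ℝ)) := fun δ =>
    {z | ∀ t x y, |distF P X t x - distF P X t y| ≤ δ → |z (t, x) - z (t, y)| ≤ ε} with hV
  have hVc : ∀ δ, IsClosed (V δ) := fun δ => by
    have he : ∀ p q, Continuous fun z : LInf (E × ℝ) => |(z p : ℝ) - (z q : ℝ)| := fun p q =>
      (Continuous.sub (f := fun z : LInf (E × ℝ) => (z p : ℝ)) (g := fun z => (z q : ℝ))
        (lp.evalCLM ℝ (fun _ : E × ℝ => ℝ) ∞ p).continuous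
        (lp.evalCLM ℝ (fun _ : E × ℝ => ℝ) ∞ q).continuous).abs
    simp only [hV, Set.ofPred_forall]
    exact isClosed_iInter fun t => isClosed_iInter fun x => isClosed_iInter fun y =>
      isClosed_iInter fun _ => isClosed_le (he _ _) continuous_const
  -- the three exceptional events
  have h1 : Tendsto (fun k : ℕ => Ph {ω | (k : ℝ) < ‖W ω‖}) atTop (𝓝 0) := by
    refine tendsto_measure_zero_of_ae_eventually_notMem
      (fun k => measurableSet_lt measurable_const hWm.norm.measurable)
      (Eventually.of_forall fun ω => ?_)
    filter_upwards [eventually_ge_atTop ⌈‖W ω‖⌉₊] with k hk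
    exact not_lt.2 (Nat.ceil_le.1 hk)
  have h2 : Tendsto (fun k : ℕ => Ph {ω | W ω ∉ V (1 / ((k : ℝ) + 1))}) atTop (𝓝 0) := by
    refine tendsto_measure_zero_of_ae_eventually_notMem
      (fun k => (hWm.measurable (hVc _).measurableSet).compl) ?_
    filter_upwards [(hg.preserving 0).quasiMeasurePreserving.ae
      (hclt.ae_uniformlyContinuous hX)] with ω hω
    obtain ⟨δ, hδ, h⟩ := hω ε hε0
    obtain ⟨N, hN⟩ := exists_nat_one_div_lt hδ
    filter_upwards [eventually_ge_atTop N] with k hk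
    refine not_not.2 fun t x y hxy => ?_
    simp only [hW, hZ]
    refine h t x y (hxy.trans (le_trans ?_ hN.le))
    exact one_div_le_one_div_of_le (by positivity) (by exact_mod_cast Nat.succ_le_succ hk)
  have h3 : Tendsto (fun n : ℕ => Ph {ω | ENNReal.ofReal ε < D n ω}) atTop (𝓝 0) := by
    refine tendsto_measure_zero_of_ae_eventually_notMem
      (fun n => measurableSet_lt measurable_const (measurable_cover _ _)) ?_
    filter_upwards [hg.conv] with ω hω
    filter_upwards [hω.eventually (gt_mem_nhds (ENNReal.ofReal_pos.2 hε0))] with n hn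
    exact not_lt.2 (le_of_lt hn)
  rw [ENNReal.tendsto_nhds_zero]
  intro σ hσ
  have hσ3 : 0 < σ / 3 := ENNReal.div_pos hσ.ne' (by norm_num)
  obtain ⟨K, hK⟩ := (ENNReal.tendsto_nhds_zero.1 h1 _ hσ3).exists
  obtain ⟨k, hk⟩ := (ENNReal.tendsto_nhds_zero.1 h2 _ hσ3).exists
  set δ : ℝ := 1 / ((k : ℝ) + 1) with hδ
  have hδ0 : 0 < δ := by positivity
  obtain ⟨θ, hθ, c, hc, hfbelow⟩ := hbelow a b ha hab hb
  set L : ℝ := K + ε + ε with hL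
  have hL0 : 0 < L := by positivity
  -- with this `κ` the error of the linear approximation is at most `ε`
  obtain ⟨δ', hδ', hfκ⟩ := Metric.uniformEquicontinuous_iff.1 hequi (ε * c / L) (by positivity)
  have hsqrt : Tendsto (fun n : ℕ => √(n : ℝ)) atTop atTop :=
    Real.tendsto_sqrt_atTop.comp tendsto_natCast_atTop_atTop
  filter_upwards [ENNReal.tendsto_nhds_zero.1 h3 _ hσ3, eventually_ne_atTop 0,
    hsqrt.eventually_gt_atTop 0, hsqrt.eventually_ge_atTop (L / δ),
    hsqrt.eventually_ge_atTop (L / (c * θ)), hsqrt.eventually_gt_atTop (L / (c * δ'))]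
    with n hn hn0 hr hrδ hrθ hrδ'
  set r := √(n : ℝ) with hrdef
  -- the bound on the distance of the empirical quantile from the true one
  set d := L / (r * c) with hd
  have hd0 : 0 < d := by positivity
  have hdθ : d ≤ θ := by
    rw [hd, div_le_iff₀ (by positivity)]
    rw [div_le_iff₀ (by positivity)] at hrθ
    linarith
  have hdδ' : d < δ' := by
    rw [hd, div_lt_iff₀ (by positivity)]
    rw [div_lt_iff₀ (by positivity)] at hrδ'
    linarith
  set B : Set Ωh := {ω | (K : ℝ) < ‖W ω‖} ∪ {ω | W ω ∉ V δ} ∪ {ω | ENNReal.ofReal ε < D n ω}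
    with hB
  have hBm : MeasurableSet B :=
    ((measurableSet_lt measurable_const hWm.norm.measurable).union
      (hWm.measurable (hVc _).measurableSet).compl).union
      (measurableSet_lt measurable_const (measurable_cover _ _))
  have hPB : Ph B ≤ σ := by
    calc Ph B ≤ σ / 3 + σ / 3 + σ / 3 := (measure_union_le _ _).trans
          (add_le_add ((measure_union_le _ _).trans (add_le_add hK hk)) hn)
      _ = σ := ENNReal.add_thirds σ
  refine le_trans (measure_mono_ae ?_) hPB
  set R : Ωh → ℝ≥0∞ := fun ω' => supNorm (fun p : E × Set.Icc a b =>
    r * (leftInv (empF Xs n (g n ω') p.1) p.2 - leftInv (distF P X p.1) p.2)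
      * f p.1 (leftInv (distF P X p.1) p.2)
      + G (g 0 ω') (p.1, leftInv (distF P X p.1) p.2)) with hR
  have hcov : cover Ph R ≤ᵐ[Ph] fun ω => if ω ∈ B then ∞ else ENNReal.ofReal (4 * ε) := by
    refine cover_le_ae _ _ _ (Measurable.ite hBm measurable_const measurable_const)
      (Eventually.of_forall fun ω => ?_)
    by_cases hω : ω ∈ B
    · simp [hω]
    simp only [hω, if_false]
    simp only [hB, Set.mem_union, Set.mem_ofPred_eq, not_or, not_lt, not_not] at hω
    obtain ⟨⟨hωK, hωV⟩, hωD⟩ := hω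
    refine iSup_le fun p => ?_
    rw [← ofReal_norm]
    refine ENNReal.ofReal_le_ofReal ?_
    have hα0 : 0 < (p.2 : ℝ) := ha.trans_le p.2.2.1
    have hα1 : (p.2 : ℝ) < 1 := p.2.2.2.trans_lt hb
    have hbound := abs_quantile_add_le (F := distF P X p.1) (Fn := empF Xs n (g n ω) p.1)
      (f := f p.1) (z := fun x => G (g 0 ω) (p.1, x)) (K := K) (ε := ε) (η := ε) (δ := δ) (c := c)
      (d := d) (κ := ε * c / L) (r := r)
      (hderiv p.1) (hmono p.1) (distF_leftInv (hX p.1) (hFc p.1) (hmono p.1) hα0 hα1)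
      (fun x hx => empF_lt_of_lt_leftInv hα0 hx) (fun x hx => le_empF_of_leftInv_lt hn0 hα1.le hx)
      hr (fun x => ?_) (fun x => ?_) hδ0 (fun x y hxy => ?_) ?_ hd0 ?_
      (fun x hx => hfbelow p.1 p.2 p.2.2 x (hx.trans hdθ))
      (fun x hx => (hfκ x _ (by rw [Real.dist_eq]; exact hx.trans_lt hdδ') p.1).le)
    · refine hbound.trans (le_of_eq ?_)
      rw [hd]; field_simp; ring
    · have h4 := (le_iSup (fun s => ‖(empProcess P X Xs n (g n ω) s - G (g 0 ω) s)‖ₑ)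
        (p.1, x)).trans ((le_cover Ph (fun ω' => supNorm
        (fun s => empProcess P X Xs n (g n ω') s - G (g 0 ω') s)) ω).trans hωD)
      rw [← ofReal_norm, ENNReal.ofReal_le_ofReal_iff hε0.le] at h4
      exact h4
    · simp only [← hZ]
      exact (lp.norm_apply_le_norm ENNReal.top_ne_zero (W ω) (p.1, x)).trans hωK
    · have := hωV p.1 x y hxy
      simpa only [hW, hZ] using this
    · rwa [div_le_iff₀ hδ0] at hrδ
    · rw [hd]; field_simp; rfl
  filter_upwards [hcov] with ω hω hlt
  by_contra hωB
  have h5 : cover Ph R ω ≤ ENNReal.ofReal (4 * ε) := by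
    have hωB' : ω ∉ B := hωB
    simpa only [hωB', if_false] using hω
  have h6 : ENNReal.ofReal ε₀ < ENNReal.ofReal (4 * ε) := lt_of_lt_of_le hlt h5
  rw [ENNReal.ofReal_lt_ofReal_iff (by positivity)] at h6
  linarith

end Quantile

end QuantileCLT

open QuantileCLT

theorem mainTheorem3 {E : Type*}
    {Ω₀ : Type*} [MeasurableSpace Ω₀] (P : Measure Ω₀) [IsProbabilityMeasure P]
    (X : Ω₀ → E → ℝ)
    {Ω : Type u} [MeasurableSpace Ω] (Q : Measure Ω) [IsProbabilityMeasure Q]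
    (Xs : ℕ → Ω → E → ℝ) (G : Ω → E × ℝ → ℝ) (f : E → ℝ → ℝ)
    (hiid : QuantileCLT.IsIIDCopies P X Q Xs)
    (hmono : ∀ t, StrictMono (QuantileCLT.distF P X t))
    (hdens : QuantileCLT.HasDensities P X f)
    (hequi : UniformEquicontinuous f)
    (hbelow : QuantileCLT.BoundedBelowNearQuantiles P X f)
    (hclt : QuantileCLT.EmpiricalCLT P X Q Xs G) :
    -- a representation space exists
    (∃ (Ωh : Type u) (_ : MeasurableSpace Ωh) (Ph : Measure Ωh) (g : ℕ → Ωh → Ω),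
      QuantileCLT.IsRepresentation Q (QuantileCLT.empProcess P X Xs) G Ph g) ∧
    -- and on each representation space the conclusions hold
    ∀ (Ωh : Type v) [MeasurableSpace Ωh] (Ph : Measure Ωh) (g : ℕ → Ωh → Ω),
      QuantileCLT.IsRepresentation Q (QuantileCLT.empProcess P X Xs) G Ph g →
      ∀ a b : ℝ, 0 < a → a ≤ b → b < 1 →
        let τ : E → ℝ → ℝ := fun t α => QuantileCLT.leftInv (QuantileCLT.distF P X t) α
        let τh : ℕ → Ωh → E → ℝ → ℝ := fun n ω t α =>
          QuantileCLT.leftInv (QuantileCLT.empF Xs n (g n ω) t) α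
        let Gh : Ωh → E × ℝ → ℝ := fun ω => G (g 0 ω)
        (∀ ε : ℝ, 0 < ε → Tendsto (fun n : ℕ => Ph {ω | ENNReal.ofReal ε <
            QuantileCLT.cover Ph (fun ω' => QuantileCLT.supNorm
              (fun p : E × Set.Icc a b =>
                √(n : ℝ) * (τh n ω' p.1 p.2 - τ p.1 p.2) * f p.1 (τ p.1 p.2)
                  + Gh ω' (p.1, τ p.1 p.2))) ω}) atTop (𝓝 0)) ∧
        QuantileCLT.SatisfiesCLT Ph
          (fun n ω (p : E × Set.Icc a b) =>
            √(n : ℝ) * (τh n ω p.1 p.2 - τ p.1 p.2) * f p.1 (τ p.1 p.2))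
          Ph (fun ω p => Gh ω (p.1, τ p.1 p.2)) ∧
        QuantileCLT.SatisfiesCLT Ph
          (fun n ω (p : E × Set.Icc a b) => √(n : ℝ) * (τh n ω p.1 p.2 - τ p.1 p.2))
          Ph (fun ω p => Gh ω (p.1, τ p.1 p.2) / f p.1 (τ p.1 p.2)) := by
  have hX : ∀ t, AEMeasurable (fun ω => X ω t) P := fun t =>
    (measurable_pi_apply t).comp_aemeasurable (hiid.copy 0).aemeasurable_snd
  obtain ⟨Z', hZ', hZ⟩ := hclt.clt.radon
  refine ⟨hclt.clt.law.exists_isRepresentation hZ' hZ, ?_⟩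
  intro Ωh _ Ph g hg a b ha hab hb τ τh Gh
  have := hg.prob
  have hlim : ∀ ε : ℝ, 0 < ε → Tendsto (fun n : ℕ => Ph {ω | ENNReal.ofReal ε <
      cover Ph (fun ω' => supNorm (fun p : E × Set.Icc a b =>
        √(n : ℝ) * (τh n ω' p.1 p.2 - τ p.1 p.2) * f p.1 (τ p.1 p.2)
          + Gh ω' (p.1, τ p.1 p.2))) ω}) atTop (𝓝 0) := fun ε hε =>
    tendsto_measure_cover_quantile hX hmono hdens hequi hbelow hclt hg ha hab hb hε
  have hWm : StronglyMeasurable fun ω => Z' (g 0 ω) :=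
    hZ'.comp_measurable (hg.preserving 0).measurable
  have hWG : IsGaussianProcess (fun s ω => Z' (g 0 ω) s) Ph := by
    simp only [hZ]
    exact isGaussianProcess_comp_measurePreserving hclt.clt.gaussian (hg.preserving 0)
  have hW0 : ∀ s, ∫ ω, Z' (g 0 ω) s ∂Ph = 0 := fun s => by
    have hm : AEStronglyMeasurable (fun ω => G ω s) (Ph.map (g 0)) := by
      rw [(hg.preserving 0).map_eq]
      exact (hclt.clt.gaussian.aemeasurable s).aestronglyMeasurable
    have h1 := integral_map (hg.preserving 0).measurable.aemeasurable hm
    rw [(hg.preserving 0).map_eq, hclt.clt.centered s] at h1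
    simp only [hZ]
    exact h1.symm
  obtain ⟨θ, hθ, c, hc, hfc⟩ := hbelow a b ha hab hb
  have hfτ : ∀ p : E × Set.Icc a b, c ≤ f p.1 (τ p.1 p.2) := fun p =>
    hfc p.1 p.2 p.2.2 _ (by simpa [τ] using hθ.le)
  -- the two processes approach `-G` with weights `1` and `1 / f`
  refine ⟨hlim, ?_, ?_⟩
  · have h := satisfiesCLT_of_tendsto_cover_add (P := Ph)
      (Y := fun n ω (p : E × Set.Icc a b) =>
        √(n : ℝ) * (τh n ω p.1 p.2 - τ p.1 p.2) * f p.1 (τ p.1 p.2))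
      hWm hWG hW0 (fun p : E × Set.Icc a b => (p.1, τ p.1 p.2)) (m := fun _ => 1) (C := 1)
      (by simp) (by simpa only [one_mul, hZ] using hlim)
    simpa only [one_mul, hZ] using h
  · have hm : ∀ p : E × Set.Icc a b, |(f p.1 (τ p.1 p.2))⁻¹| ≤ c⁻¹ := fun p => by
      rw [abs_of_pos (inv_pos.2 (hc.trans_le (hfτ p)))]
      exact inv_anti₀ hc (hfτ p)
    have h := satisfiesCLT_of_tendsto_cover_add (P := Ph)
      (Y := fun n ω (p : E × Set.Icc a b) => √(n : ℝ) * (τh n ω p.1 p.2 - τ p.1 p.2))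
      hWm hWG hW0 (fun p : E × Set.Icc a b => (p.1, τ p.1 p.2))
      (m := fun p => (f p.1 (τ p.1 p.2))⁻¹) hm fun ε hε => by
        refine (tendsto_measure_cover_mul hlim (inv_pos.2 hc) hm hε).congr fun n => ?_
        have : ∀ ω (p : E × Set.Icc a b), (f p.1 (τ p.1 p.2))⁻¹ *
            (√(n : ℝ) * (τh n ω p.1 p.2 - τ p.1 p.2) * f p.1 (τ p.1 p.2)
              + Gh ω (p.1, τ p.1 p.2)) =
            √(n : ℝ) * (τh n ω p.1 p.2 - τ p.1 p.2)
              + (f p.1 (τ p.1 p.2))⁻¹ * Z' (g 0 ω) (p.1, τ p.1 p.2) := fun ω p => by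
          have := (hc.trans_le (hfτ p)).ne'
          rw [hZ]
          simp only [Gh]
          field_simp
        simp only [this]
    have hdiv : ∀ ω (p : E × Set.Icc a b), Gh ω (p.1, τ p.1 p.2) / f p.1 (τ p.1 p.2) =
        (f p.1 (τ p.1 p.2))⁻¹ * Z' (g 0 ω) (p.1, τ p.1 p.2) := fun ω p => by
      rw [hZ, div_eq_inv_mul]
    simp only [hdiv]
    exact h
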